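/- Let $d\ge 1$ be an integer and let $r,m,\omega,\hbar>0$; put $\tau=\hbar/(m\omega r^2)$. Let $S^d=\{x\in\mathbb R^{d+1}: x_1^2+\cdots+x_{d+1}^2=r^2\}$, with surface area measure $dx$, and let $S^d_{\mathbb C}=\{a\in\mathbb C^{d+1}: a_1^2+\cdots+a_{d+1}^2=r^2\}$. In the Hilbert space $L^2(S^d)$ let $X_k$ be multiplication by $x_k$, let $J_{kl}=-i\hbar\,(x_l\,\partial/\partial x_k-x_k\,\partial/\partial x_l)$ on $C^\infty(S^d)$, and put $J^2=\sum_{k<l}J_{kl}^2$, $\tilde J^2=J^2/\hbar^2$. Functions of $\tilde J^2$ are defined through the expansion in spherical harmonics (the smooth eigenfunctions of $\tilde J^2$). The annihilation operators are $A_k=e^{-\tau\tilde J^2/2}X_k\,e^{\tau\tilde J^2/2}$, defined first on finite linear combinations of spherical harmonics and then on their maximal domain: $\phi\in L^2(S^d)$ is in the domain of $A_k$ if the series of spherical harmonics obtained by applying $A_k$ term by term to the expansion of $\phi$, and collecting the finitely many contributions to each eigenspace of $\tilde J^2$, converges in $L^2(S^d)$; then $A_k\phi$ is its sum. A generalized state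 $|\Psi\rangle$ is an antilinear functional $f\mapsto\langle f|\Psi\rangle$ on $C^\infty(S^d)$; it is normalizable if it is given by the inner product with a vector of $L^2(S^d)$. For $a\in S^d$ let $|\delta_a\rangle$ be the position eigenstate $\langle f|\delta_a\rangle=\overline{f(a)}$, and define $e^{-\tau\tilde J^2/2}|\delta_a\rangle$ by $\langle f|e^{-\tau\tilde J^2/2}|\delta_a\rangle=\overline{(e^{-\tau\tilde J^2/2}f)(a)}$, where the continuous representative of $e^{-\tau\tilde J^2/2}f$ is used. Then there is exactly one family of generalized states $|\psi_a\rangle$, $a\in S^d_{\mathbb C}$, such that (1) it depends holomorphically on $a$ (that is, $a\mapsto\langle f|\psi_a\rangle$ is holomorphic on $S^d_{\mathbb C}$ for each $f\in C^\infty(S^d)$), and (2) $|\psi_a\rangle=e^{-\tau\tilde J^2/2}|\delta_a\rangle$ for all $a\in S^d$. Moreover: - These states are normalizable, and $a\mapsto|\psi_a\rangle$ is holomorphic as a map from $S^d_{\mathbb C}$ to $L^2(S^d)$. - They are simultaneous eigenvectors of the annihilation operators: for every $a\in S^d_{\mathbb C}$, $\psi_a\neq 0$, $\psi_a$ is in the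 maximal domain of every $A_k$, and $A_k|\psi_a\rangle=a_k|\psi_a\rangle$, $k=1,\dots,d+1$. - The heat kernel $\rho_\tau(x,y)$ on $S^d\times S^d$, that is, the continuous integral kernel of $e^{-\tau\tilde J^2/2}$, exists and has a unique holomorphic extension to $S^d_{\mathbb C}\times S^d_{\mathbb C}$, also denoted $\rho_\tau$, and in the position representation $\langle\delta_x|\psi_a\rangle=\rho_\tau(a,x)$ for all $a\in S^d_{\mathbb C}$ and (almost all) $x\in S^d$. -/

import Mathlib

open MeasureTheory
open scoped ContDiff ComplexConjugate

/-- A nonrelativistic quantum particle (mass `m`) on the `d`-dimensional sphere of radius `r`,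
together with the frequency `ω = freq` that fixes the complexifier, and Planck's constant `ħ = hbar`. -/
structure SphereParticle where
  d : ℕ
  r : ℝ
  m : ℝ
  freq : ℝ
  hbar : ℝ
  one_le_d : 1 ≤ d
  r_pos : 0 < r
  m_pos : 0 < m
  freq_pos : 0 < freq
  hbar_pos : 0 < hbar

/-- `F : X → V` is holomorphic, where `X` is a complex submanifold of `E` embedded by `ι`:
near every point `F` is the restriction of a holomorphic function on an open subset of `E`. -/
def IsHolomorphicAlong {X E V : Type*} [NormedAddCommGroup E] [NormedSpace ℂ E]
    [NormedAddCommGroup V] [NormedSpace ℂ V] (ι : X → E) (F : X → V) : Prop :=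
  ∀ x : X, ∃ (U : Set E) (G : E → V), IsOpen U ∧ ι x ∈ U ∧ DifferentiableOn ℂ G U ∧
    ∀ y : X, ι y ∈ U → G (ι y) = F y

namespace SphereParticle

noncomputable section

variable (P : SphereParticle)

/-- The ambient Euclidean space `ℝ^{d+1}`. -/
abbrev Ambient : Type := EuclideanSpace ℝ (Fin (P.d + 1))

/-- The configuration space `S^d`, the sphere of radius `r` in `ℝ^{d+1}`. -/
abbrev Sphere : Type := Metric.sphere (0 : P.Ambient) P.r

/-- The complexified sphere `S^d_ℂ = {a ∈ ℂ^{d+1} | a_1² + ⋯ + a_{d+1}² = r²}`. -/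
abbrev ComplexSphere : Type := {a : Fin (P.d + 1) → ℂ // ∑ k, a k ^ 2 = (P.r : ℂ) ^ 2}

/-- The inclusion of the real sphere into the complexified sphere. -/
def ofReal (x : P.Sphere) : P.ComplexSphere :=
  ⟨fun k => ((x : P.Ambient) k : ℂ), by
    have h : ‖(x : P.Ambient)‖ ^ 2 = P.r ^ 2 := by rw [mem_sphere_zero_iff_norm.1 x.2]
    rw [EuclideanSpace.norm_sq_eq] at h
    simp only [Real.norm_eq_abs, sq_abs] at h
    have h' := congrArg (fun t : ℝ => (t : ℂ)) h
    push_cast at h'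
    exact h'⟩

/-- The homothety from the unit sphere to the sphere of radius `r`. -/
def scale (u : Metric.sphere (0 : P.Ambient) 1) : P.Sphere :=
  ⟨P.r • (u : P.Ambient), by simp [norm_smul, abs_of_pos P.r_pos]⟩

/-- The surface area measure on the sphere of radius `r`: it is `r^d` times the image of the
surface area measure on the unit sphere. -/
def surfaceMeasure : Measure P.Sphere :=
  ENNReal.ofReal (P.r ^ P.d) • (volume : Measure P.Ambient).toSphere.map P.scale

instance : IsFiniteMeasure P.surfaceMeasure :=
  ⟨by
    rw [surfaceMeasure, Measure.smul_apply, smul_eq_mul]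
    exact ENNReal.mul_lt_top ENNReal.ofReal_lt_top (measure_lt_top _ _)⟩

/-- The quantum Hilbert space `L²(S^d)` of the position representation. -/
abbrev Hilb : Type := Lp ℂ 2 P.surfaceMeasure

/-- The vector of the Hilbert space given by a continuous function. -/
def toL2 : C(P.Sphere, ℂ) →L[ℂ] P.Hilb := ContinuousMap.toLp 2 P.surfaceMeasure ℂ

open Classical in
/-- The extension of `f : S^d → ℂ` to `ℝ^{d+1} ∖ {0}` that is constant along rays. -/
def radialExt (f : P.Sphere → ℂ) (y : P.Ambient) : ℂ :=
  if h : (P.r / ‖y‖) • y ∈ Metric.sphere (0 : P.Ambient) P.r then f ⟨(P.r / ‖y‖) • y, h⟩ else 0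

/-- The space `C^∞(S^d)` of smooth complex-valued functions on the sphere. -/
def Smooth : Submodule ℂ C(P.Sphere, ℂ) where
  carrier := {f | ContDiffOn ℝ ∞ (P.radialExt f) {0}ᶜ}
  zero_mem' := by
    have h : P.radialExt (0 : C(P.Sphere, ℂ)) = fun _ => 0 := by
      funext y; simp [radialExt]
    simp only [Set.mem_ofPred_eq, h]
    exact contDiffOn_const
  add_mem' := by
    intro f g hf hg
    have h : P.radialExt (f + g : C(P.Sphere, ℂ)) =
        fun y => P.radialExt f y + P.radialExt g y := by
      funext y; unfold radialExt; split_ifs <;> simp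
    simp only [Set.mem_ofPred_eq, h] at hf hg ⊢
    exact hf.add hg
  smul_mem' := by
    intro c f hf
    have h : P.radialExt (c • f : C(P.Sphere, ℂ)) = fun y => c • P.radialExt f y := by
      funext y; unfold radialExt; split_ifs <;> simp
    simp only [Set.mem_ofPred_eq, h] at hf ⊢
    exact hf.const_smul c

/-- The angular momentum operators `J_{kl} = -iħ (x_l ∂/∂x_k - x_k ∂/∂x_l)`. The vector field is
tangent to the sphere, so that any smooth extension of `f` to a neighbourhood may be used. -/
def J (k l : Fin (P.d + 1)) (f : P.Sphere → ℂ) (x : P.Sphere) : ℂ :=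
  -Complex.I * P.hbar * fderiv ℝ (P.radialExt f) x
    ((x : P.Ambient) l • EuclideanSpace.single k (1 : ℝ) -
      (x : P.Ambient) k • EuclideanSpace.single l (1 : ℝ))

/-- The total angular momentum `J² = ∑_{k<l} J_{kl}²`. -/
def Jsq (f : P.Sphere → ℂ) (x : P.Sphere) : ℂ :=
  ∑ k, ∑ l ∈ Finset.Ioi k, P.J k l (P.J k l f) x

/-- The dimensionless total angular momentum `J̃² = J² / ħ²`. -/
def JsqTilde (f : P.Sphere → ℂ) (x : P.Sphere) : ℂ := P.Jsq f x / (P.hbar : ℂ) ^ 2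

/-- The dimensionless parameter `τ = ħ / (m ω r²)`. -/
def τ : ℝ := P.hbar / (P.m * P.freq * P.r ^ 2)

/-- The subspace of `L²(S^d)` of the spherical harmonics with `J̃² f = lam f`. -/
def eigenspace (lam : ℝ) : Submodule ℂ P.Hilb :=
  Submodule.span ℂ
    {φ | ∃ f ∈ P.Smooth, (∀ x, P.JsqTilde f x = (lam : ℂ) * f x) ∧ P.toL2 f = φ}

/-- The orthogonal projection onto the (closed) eigenspace of `J̃²` with eigenvalue `lam`; thus
`proj lam φ` is the term of the expansion of `φ` in spherical harmonics that belongs to `lam`. -/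
def proj (lam : ℝ) : P.Hilb →L[ℂ] P.Hilb :=
  (P.eigenspace lam).topologicalClosure.starProjection

/-- The operator `e^{s J̃²}`, through the expansion in spherical harmonics. It is used only for
`s < 0` on the whole Hilbert space, and for `s > 0` on finite combinations of spherical
harmonics. -/
def expJ (s : ℝ) (φ : P.Hilb) : P.Hilb :=
  ∑' lam : ℝ, ((Real.exp (s * lam) : ℝ) : ℂ) • P.proj lam φ

/-- The coordinate function `x ↦ x_k` on the sphere. -/
def coord (k : Fin (P.d + 1)) : C(P.Sphere, ℂ) :=
  ⟨fun x => ((x : P.Ambient) k : ℂ), by fun_prop⟩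

/-- The position operator `X_k`, multiplication by `x_k`. -/
def X (k : Fin (P.d + 1)) (φ : P.Hilb) : P.Hilb :=
  MemLp.toLp (fun x => P.coord k x * φ x)
    ((Lp.memLp φ).of_le_mul (c := ‖P.coord k‖)
      ((P.coord k).continuous.aestronglyMeasurable.mul (Lp.aestronglyMeasurable φ))
      (Filter.Eventually.of_forall fun x => by
        rw [norm_mul]
        exact mul_le_mul_of_nonneg_right ((P.coord k).norm_coe_le_norm x) (norm_nonneg _)))

/-- The annihilation operator `A_k = e^{-τJ̃²/2} X_k e^{τJ̃²/2}` on its minimal domain, the finite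
linear combinations of spherical harmonics. -/
def annihilationMin (k : Fin (P.d + 1)) (φ : P.Hilb) : P.Hilb :=
  P.expJ (-(P.τ / 2)) (P.X k (P.expJ (P.τ / 2) φ))

/-- `φ` lies in the maximal domain of `A_k`, and `A_k φ = η`: the operator `A_k` is applied term by
term to the expansion of `φ` in spherical harmonics, the contributions (only finitely many are
nonzero) to each eigenspace of `J̃²` are collected, and the resulting series of spherical harmonics
converges in the Hilbert space, with sum `η`. -/
def AnnihilationEq (k : Fin (P.d + 1)) (φ η : P.Hilb) : Prop :=
  HasSum (fun lam : ℝ => ∑ᶠ mu : ℝ, P.proj lam (P.annihilationMin k (P.proj mu φ))) η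

/-- Generalized (possibly non-normalizable) states `|Ψ⟩`, given by the antilinear functional
`f ↦ ⟨f|Ψ⟩` on the smooth functions on the sphere. -/
abbrev GenState : Type := P.Smooth →ₗ⋆[ℂ] ℂ

/-- The generalized state `f ↦ ⟨f|φ⟩` given by a vector `φ` of the Hilbert space. -/
def ket (φ : P.Hilb) : P.GenState where
  toFun f := inner ℂ (P.toL2 f) φ
  map_add' f g := by simp [inner_add_left]
  map_smul' c f := by simp [inner_smul_left]

/-- The position eigenstate `|δ_a⟩`, `⟨g|δ_a⟩ = conj (g a)`, defined on all continuous `g`. -/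
def delta (a : P.Sphere) : C(P.Sphere, ℂ) →ₗ⋆[ℂ] ℂ where
  toFun g := conj (g a)
  map_add' f g := by simp
  map_smul' c f := by simp

/-- `Ψ = e^{-τJ̃²/2} T`, by transposition: `⟨f|Ψ⟩ = ⟨e^{-τJ̃²/2} f|T⟩` for all smooth `f`, where
`e^{-τJ̃²/2} f` stands for its continuous representative `g`. -/
def IsSmoothingOf (T : C(P.Sphere, ℂ) →ₗ⋆[ℂ] ℂ) (Ψ : P.GenState) : Prop :=
  ∀ (f : P.Smooth) (g : C(P.Sphere, ℂ)),
    P.toL2 g = P.expJ (-(P.τ / 2)) (P.toL2 f) → Ψ f = T g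

/-- A family of generalized states `|Ψ_a⟩`, `a ∈ S^d_ℂ`, which depends holomorphically on `a` and
equals `e^{-τJ̃²/2} |δ_a⟩` for `a ∈ S^d`. -/
def IsCoherentFamily (Ψ : P.ComplexSphere → P.GenState) : Prop :=
  (∀ f : P.Smooth, IsHolomorphicAlong (Subtype.val : P.ComplexSphere → _) fun a => Ψ a f) ∧
  ∀ a : P.Sphere, P.IsSmoothingOf (P.delta a) (Ψ (P.ofReal a))

/-- `ρ` is the heat kernel `ρ_τ` on `S^d`, that is, the continuous integral kernel
`⟨δ_x|e^{-τJ̃²/2}|δ_y⟩` of `e^{-τJ̃²/2}`. -/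
def IsHeatKernel (ρ : P.Sphere × P.Sphere → ℂ) : Prop :=
  Continuous ρ ∧ ∀ φ : P.Hilb,
    P.expJ (-(P.τ / 2)) φ =ᵐ[P.surfaceMeasure] fun x => ∫ y, ρ (x, y) * φ y ∂P.surfaceMeasure

/-- `ρ` is a holomorphic extension of the heat kernel `ρ_τ` to `S^d_ℂ × S^d_ℂ`. -/
def IsContinuedHeatKernel (ρ : P.ComplexSphere × P.ComplexSphere → ℂ) : Prop :=
  IsHolomorphicAlong
    (Prod.map Subtype.val Subtype.val :
      P.ComplexSphere × P.ComplexSphere → (Fin (P.d + 1) → ℂ) × (Fin (P.d + 1) → ℂ)) ρ ∧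
  P.IsHeatKernel fun p => ρ (P.ofReal p.1, P.ofReal p.2)

end

end SphereParticle

/-! Everything is expanded in spherical harmonics, realized as restrictions of polynomials. On
polynomials of degree at most n, J̃² is multiplication by n(n+d-1) up to terms of lower degree
(`sqSum_sub_mem`), and it is symmetric because rotations preserve the surface measure (`inner_lap`).
Hence the orthogonal complement `harm n` of the lower degrees inside degree n consists of
eigenvectors (`exists_of_mem_harm`). By Stone–Weierstrass these spaces exhaust L²
(`eq_zero_of_orthogonal`), so they are all the nonzero eigenspaces.

The element Z_n(a) of `harm n` that reproduces the value at a real point a is polynomial in a, hence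
defined for complex a. The coherent state is ψ_a = ∑ e^{-τn(n+d-1)/2} Z_n(a). On the real sphere,
point evaluations on degree n are bounded by C^n (`norm_apply_le`). The maximum principle on a
complexified great circle extends this to complex points at the price of another factor C(a)^n
(`norm_eval_le`). The Gaussian factor beats both, locally uniformly in a, and a local holomorphic
retraction onto the complexified sphere makes the sum holomorphic (`isHolomorphicAlong_tsum`).
Uniqueness is the identity theorem on entire curves that are real at real times (`exists_curve`).

For the eigenvalue equation, multiplication by x_k is symmetric, so the reproducing property gives
∑_n Q_m(x_k Z_n(a)) = a_k Z_m(a), a finite sum (`sum_Q_coordZonal`). Conjugation by the exponentials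
removes the factor of degree n and inserts that of degree m, which turns this into A_k ψ_a = a_k ψ_a
degree by degree. The heat kernel is the double series ∑ e^{-τn(n+d-1)/2} Z_n(a)(b), controlled by
the same estimates. -/

namespace SphereParticle

noncomputable section

open scoped Pointwise

variable (P : SphereParticle)

/-! ### The surface measure and isometries -/

instance : CompactSpace P.Sphere := isCompact_iff_compactSpace.1 (isCompact_sphere _ _)

lemma finrank_ambient : Module.finrank ℝ P.Ambient = P.d + 1 := by simp

lemma continuous_scale : Continuous P.scale := by
  unfold scale; fun_prop

lemma scale_surjective : Function.Surjective P.scale := by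
  intro x
  have hx : ‖(x : P.Ambient)‖ = P.r := mem_sphere_zero_iff_norm.1 x.2
  refine ⟨⟨P.r⁻¹ • (x : P.Ambient), ?_⟩, ?_⟩
  · simp [norm_smul, abs_of_pos P.r_pos, hx, P.r_pos.ne']
  · ext1
    simp [scale, smul_smul, P.r_pos.ne']

/-- Makes continuous functions embed into L², so that identities between polynomial functions can be
checked in the Hilbert space. -/
instance : P.surfaceMeasure.IsOpenPosMeasure := by
  have h1 : ((volume : Measure P.Ambient).toSphere.map P.scale).IsOpenPosMeasure :=
    P.continuous_scale.isOpenPosMeasure_map P.scale_surjective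
  constructor
  intro U hU hne
  rw [surfaceMeasure, Measure.smul_apply, smul_eq_mul]
  exact mul_ne_zero (by simp [P.r_pos]) (hU.measure_ne_zero _ hne)

instance : Nonempty P.Sphere := by
  refine ⟨⟨P.r • EuclideanSpace.single 0 1, ?_⟩⟩
  simp [norm_smul, abs_of_pos P.r_pos]

lemma surfaceMeasure_real_univ_pos : 0 < P.surfaceMeasure.real Set.univ := by
  rw [measureReal_def]
  exact ENNReal.toReal_pos (isOpen_univ.measure_ne_zero _ Set.univ_nonempty) (measure_ne_top _ _)

/-- The action of a linear isometry on a sphere. -/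
def sphereMap {ρ : ℝ} (R : P.Ambient ≃ₗᵢ[ℝ] P.Ambient) :
    C(Metric.sphere (0 : P.Ambient) ρ, Metric.sphere (0 : P.Ambient) ρ) :=
  ⟨fun x => ⟨R x, by simp⟩, by fun_prop⟩

/-- `toSphere` measures a set by the volume of the cone over it, and an isometry maps cones to cones
of the same volume. -/
lemma map_sphereMap_toSphere (R : P.Ambient ≃ₗᵢ[ℝ] P.Ambient) :
    (volume : Measure P.Ambient).toSphere.map (P.sphereMap R) =
      (volume : Measure P.Ambient).toSphere := by
  ext s hs
  have hm : Measurable (P.sphereMap (ρ := 1) R) := (P.sphereMap R).continuous.measurable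
  rw [Measure.map_apply hm hs, Measure.toSphere_apply' _ (hm hs), Measure.toSphere_apply' _ hs]
  congr 1
  have hR := R.measurePreserving
  have h : Set.Ioo (0 : ℝ) 1 • ((↑) '' (P.sphereMap R ⁻¹' s) : Set P.Ambient) =
      R ⁻¹' (Set.Ioo (0 : ℝ) 1 • ((↑) '' s)) := by
    ext y
    simp only [Set.mem_smul, Set.mem_preimage, Set.mem_image]
    constructor
    · rintro ⟨c, hc, _, ⟨x, hx, rfl⟩, rfl⟩
      exact ⟨c, hc, _, ⟨_, hx, rfl⟩, by simp [sphereMap]⟩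
    · rintro ⟨c, hc, _, ⟨x, hx, rfl⟩, h⟩
      refine ⟨c, hc, _, ⟨P.sphereMap R.symm x, ?_, rfl⟩, ?_⟩
      · convert! hx
        ext1
        simp [sphereMap]
      · apply R.injective
        simpa [sphereMap] using h
  rw [h]
  exact hR.measure_preimage_equiv (f := R.toMeasurableEquiv) _

lemma measurePreserving_sphereMap (R : P.Ambient ≃ₗᵢ[ℝ] P.Ambient) :
    MeasurePreserving (P.sphereMap R) P.surfaceMeasure P.surfaceMeasure := by
  refine ⟨(P.sphereMap R).continuous.measurable, ?_⟩
  rw [surfaceMeasure, Measure.map_smul]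
  congr 1
  have h : P.sphereMap R ∘ P.scale = P.scale ∘ P.sphereMap R := by
    funext x; ext1; simp [sphereMap, scale]
  rw [Measure.map_map (P.sphereMap R).continuous.measurable P.continuous_scale.measurable, h,
    ← Measure.map_map P.continuous_scale.measurable (P.sphereMap R).continuous.measurable,
    map_sphereMap_toSphere]

lemma integral_comp_sphereMap (R : P.Ambient ≃ₗᵢ[ℝ] P.Ambient) (f : C(P.Sphere, ℂ)) :
    ∫ x, f (P.sphereMap R x) ∂P.surfaceMeasure = ∫ x, f x ∂P.surfaceMeasure := by
  have h := P.measurePreserving_sphereMap R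
  conv_rhs => rw [← h.map_eq]
  rw [integral_map h.measurable.aemeasurable f.continuous.aestronglyMeasurable]

lemma exists_sphereMap_eq (x y : P.Sphere) : ∃ R : P.Ambient ≃ₗᵢ[ℝ] P.Ambient,
    P.sphereMap R x = y := by
  have h : ‖(x : P.Ambient)‖ = ‖(y : P.Ambient)‖ := by
    rw [mem_sphere_zero_iff_norm.1 x.2, mem_sphere_zero_iff_norm.1 y.2]
  refine ⟨(ℝ ∙ ((x : P.Ambient) - y))ᗮ.reflection, ?_⟩
  ext1
  exact Submodule.reflection_sub h

lemma integrable_continuousMap (f : C(P.Sphere, ℂ)) : Integrable f P.surfaceMeasure :=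
  f.continuous.integrable_of_hasCompactSupport (HasCompactSupport.of_compactSpace _)

/-! ### Rotations in coordinate planes -/

/-- The generator `x ↦ x_l e_k - x_k e_l` of the rotations in the plane of `x_k`, `x_l`. -/
def rotGen (k l : Fin (P.d + 1)) : P.Ambient →L[ℝ] P.Ambient :=
  (EuclideanSpace.proj l).smulRight (EuclideanSpace.single k (1 : ℝ)) -
    (EuclideanSpace.proj k).smulRight (EuclideanSpace.single l (1 : ℝ))

lemma rotGen_apply (k l : Fin (P.d + 1)) (x : P.Ambient) :
    P.rotGen k l x = x l • EuclideanSpace.single k (1 : ℝ) - x k • EuclideanSpace.single l 1 := by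
  simp [rotGen]

/-- The rotation by the angle `θ` in the plane of `x_k`, `x_l`, as a linear map. -/
def rotLin (k l : Fin (P.d + 1)) (θ : ℝ) : P.Ambient →L[ℝ] P.Ambient :=
  .id ℝ P.Ambient + (Real.cos θ - 1) • ((EuclideanSpace.proj k).smulRight (EuclideanSpace.single k (1 : ℝ)) +
    (EuclideanSpace.proj l).smulRight (EuclideanSpace.single l (1 : ℝ))) +
    Real.sin θ • P.rotGen k l

lemma rotLin_apply (k l : Fin (P.d + 1)) (θ : ℝ) (x : P.Ambient) :
    P.rotLin k l θ x = x + (Real.cos θ - 1) • (x k • EuclideanSpace.single k (1 : ℝ) +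
      x l • EuclideanSpace.single l 1) +
      Real.sin θ • (x l • EuclideanSpace.single k (1 : ℝ) - x k • EuclideanSpace.single l 1) := by
  simp [rotLin, rotGen]

lemma rotGen_rotLin {k l : Fin (P.d + 1)} (hkl : k ≠ l) (θ : ℝ) (x : P.Ambient) :
    P.rotGen k l (P.rotLin k l θ x) = (-Real.sin θ) • (x k • EuclideanSpace.single k (1 : ℝ) +
      x l • EuclideanSpace.single l 1) + Real.cos θ • P.rotGen k l x := by
  rw [rotGen_apply, rotGen_apply, rotLin_apply]
  ext i
  simp [hkl, hkl.symm]
  split_ifs <;> ring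

lemma norm_rotLin {k l : Fin (P.d + 1)} (hkl : k ≠ l) (θ : ℝ) (x : P.Ambient) :
    ‖P.rotLin k l θ x‖ = ‖x‖ := by
  have h : ‖P.rotLin k l θ x‖ ^ 2 = ‖x‖ ^ 2 := by
    rw [rotLin_apply, ← real_inner_self_eq_norm_sq, ← real_inner_self_eq_norm_sq]
    simp only [inner_add_left, inner_add_right, inner_sub_left, inner_sub_right,
      real_inner_smul_left, real_inner_smul_right, EuclideanSpace.inner_single_left,
      EuclideanSpace.inner_single_right]
    simp [hkl, hkl.symm]
    linear_combination (x k ^ 2 + x l ^ 2) * Real.sin_sq_add_cos_sq θ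
  exact (sq_eq_sq₀ (norm_nonneg _) (norm_nonneg _)).1 h

/-- The rotation by the angle `θ` in the plane of `x_k`, `x_l`. -/
def rot {k l : Fin (P.d + 1)} (hkl : k ≠ l) (θ : ℝ) : P.Ambient ≃ₗᵢ[ℝ] P.Ambient :=
  LinearIsometry.toLinearIsometryEquiv ⟨(P.rotLin k l θ).toLinearMap, P.norm_rotLin hkl θ⟩ rfl

/-- The field defining J_{kl} generates a one-parameter group of isometries, so derivatives along it
are derivatives along rotations. -/
lemma hasDerivAt_rotLin {k l : Fin (P.d + 1)} (hkl : k ≠ l) (θ : ℝ) (x : P.Ambient) :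
    HasDerivAt (fun θ => P.rotLin k l θ x) (P.rotGen k l (P.rotLin k l θ x)) θ := by
  rw [rotGen_rotLin P hkl, rotGen_apply]
  simp only [rotLin_apply]
  have h1 := ((Real.hasDerivAt_cos θ).sub_const 1).smul_const
    (x k • EuclideanSpace.single k (1 : ℝ) + x l • EuclideanSpace.single l 1)
  have h2 := (Real.hasDerivAt_sin θ).smul_const
    (x l • EuclideanSpace.single k (1 : ℝ) - x k • EuclideanSpace.single l 1)
  exact (h1.const_add x).add h2

@[simp] lemma rotLin_zero (k l : Fin (P.d + 1)) (x : P.Ambient) : P.rotLin k l 0 x = x := by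
  simp [rotLin_apply]

/-! ### Smooth functions -/

lemma sphere_ne_zero (x : P.Sphere) : (x : P.Ambient) ≠ 0 := by
  intro h
  have := mem_sphere_zero_iff_norm.1 x.2
  rw [h, norm_zero] at this
  exact P.r_pos.ne this

lemma radial_mem {y : P.Ambient} (hy : y ≠ 0) :
    (P.r / ‖y‖) • y ∈ Metric.sphere (0 : P.Ambient) P.r := by
  have : ‖y‖ ≠ 0 := norm_ne_zero_iff.2 hy
  simp [norm_smul, abs_of_pos P.r_pos, this]

lemma radialExt_of_ne (f : P.Sphere → ℂ) {y : P.Ambient} (hy : y ≠ 0) :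
    P.radialExt f y = f ⟨(P.r / ‖y‖) • y, P.radial_mem hy⟩ := by
  rw [radialExt, dif_pos (P.radial_mem hy)]

@[simp] lemma radialExt_coe (f : P.Sphere → ℂ) (x : P.Sphere) :
    P.radialExt f (x : P.Ambient) = f x := by
  rw [P.radialExt_of_ne f (P.sphere_ne_zero x)]
  congr 1
  ext1
  simp [P.r_pos.ne']

lemma radialExt_mul (f g : P.Sphere → ℂ) :
    P.radialExt (f * g) = P.radialExt f * P.radialExt g := by
  funext y; simp only [radialExt, Pi.mul_apply]; split_ifs <;> simp

lemma radialExt_add (f g : P.Sphere → ℂ) :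
    P.radialExt (f + g) = P.radialExt f + P.radialExt g := by
  funext y; simp only [radialExt, Pi.add_apply]; split_ifs <;> simp

lemma radialExt_smul (c : ℂ) (f : P.Sphere → ℂ) :
    P.radialExt (c • f) = c • P.radialExt f := by
  funext y; simp only [radialExt, Pi.smul_apply]; split_ifs <;> simp

lemma contDiffOn_radial :
    ContDiffOn ℝ ∞ (fun y : P.Ambient => (P.r / ‖y‖) • y) {0}ᶜ := by
  have h : ContDiffOn ℝ ∞ (fun y : P.Ambient => ‖y‖) {0}ᶜ :=
    contDiffOn_id.norm ℝ fun x hx => hx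
  exact (contDiffOn_const.div h fun x hx => norm_ne_zero_iff.2 hx).smul contDiffOn_id

/-- The radial extension is `F` composed with the radial projection, which is smooth away from the
origin. -/
lemma contDiffOn_radialExt {f : P.Sphere → ℂ} {F : P.Ambient → ℂ}
    (hF : ContDiffOn ℝ ∞ F {0}ᶜ) (h : ∀ x : P.Sphere, f x = F x) :
    ContDiffOn ℝ ∞ (P.radialExt f) {0}ᶜ := by
  refine (hF.comp P.contDiffOn_radial ?_).congr ?_
  · intro y hy
    exact P.sphere_ne_zero ⟨_, P.radial_mem hy⟩
  · intro y hy
    rw [P.radialExt_of_ne f hy, h]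
    rfl

/-- The algebra of smooth functions on the sphere. -/
def smoothAlg : Subalgebra ℂ C(P.Sphere, ℂ) where
  carrier := P.Smooth
  mul_mem' {f g} hf hg := by
    change ContDiffOn ℝ ∞ (P.radialExt (⇑f * ⇑g)) {0}ᶜ
    rw [radialExt_mul]
    exact ContDiffOn.mul hf hg
  add_mem' hf hg := P.Smooth.add_mem hf hg
  algebraMap_mem' c := P.contDiffOn_radialExt contDiffOn_const fun _ => rfl

lemma coord_mem (k : Fin (P.d + 1)) : P.coord k ∈ P.smoothAlg := by
  refine P.contDiffOn_radialExt (F := fun y => (y k : ℂ)) ?_ fun _ => rfl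
  exact (Complex.ofRealCLM.contDiff.comp (EuclideanSpace.proj (𝕜 := ℝ) k).contDiff).contDiffOn

lemma star_mem {f : C(P.Sphere, ℂ)} (hf : f ∈ P.smoothAlg) : star f ∈ P.smoothAlg := by
  have hf' : ContDiffOn ℝ ∞ (P.radialExt f) {0}ᶜ := hf
  refine P.contDiffOn_radialExt (F := fun y => conj (P.radialExt f y)) ?_ fun x => by simp
  exact Complex.conjCLE.contDiff.comp_contDiffOn hf'

lemma hasFDerivAt_radialExt {f : C(P.Sphere, ℂ)} (hf : f ∈ P.smoothAlg) {y : P.Ambient}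
    (hy : y ≠ 0) : HasFDerivAt (P.radialExt f) (fderiv ℝ (P.radialExt f) y) y := by
  have hf' : ContDiffOn ℝ ∞ (P.radialExt f) {0}ᶜ := hf
  exact ((hf'.contDiffAt (isOpen_compl_singleton.mem_nhds hy)).differentiableAt
    (by simp)).hasFDerivAt

lemma contDiffOn_fderiv_rotGen {f : C(P.Sphere, ℂ)} (hf : f ∈ P.smoothAlg)
    (k l : Fin (P.d + 1)) :
    ContDiffOn ℝ ∞ (fun y => fderiv ℝ (P.radialExt f) y (P.rotGen k l y)) {0}ᶜ := by
  have hf' : ContDiffOn ℝ ∞ (P.radialExt f) {0}ᶜ := hf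
  have h := hf'.fderiv_of_isOpen (m := ∞) isOpen_compl_singleton (by simp)
  exact h.clm_apply (P.rotGen k l).contDiff.contDiffOn

/-- The action of the vector field `x_l ∂/∂x_k - x_k ∂/∂x_l` on a smooth function. -/
def rotFun (k l : Fin (P.d + 1)) (f : P.smoothAlg) : P.smoothAlg :=
  ⟨⟨fun x => fderiv ℝ (P.radialExt f.1) x (P.rotGen k l x), by
    have h := (P.contDiffOn_fderiv_rotGen f.2 k l).continuousOn
    exact h.comp_continuous continuous_subtype_val fun x => P.sphere_ne_zero x⟩,
    P.contDiffOn_radialExt (P.contDiffOn_fderiv_rotGen f.2 k l) fun _ => rfl⟩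

lemma rotFun_apply (k l : Fin (P.d + 1)) (f : P.smoothAlg) (x : P.Sphere) :
    (P.rotFun k l f).1 x = fderiv ℝ (P.radialExt f.1) x (P.rotGen k l x) := rfl

lemma smoothAlg_ext {f g : P.smoothAlg} (h : ∀ x, f.1 x = g.1 x) : f = g :=
  Subtype.ext (ContinuousMap.ext h)

lemma rotFun_add (k l : Fin (P.d + 1)) (f g : P.smoothAlg) :
    P.rotFun k l (f + g) = P.rotFun k l f + P.rotFun k l g := by
  refine P.smoothAlg_ext fun x => ?_
  have h := (P.hasFDerivAt_radialExt f.2 (P.sphere_ne_zero x)).add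
    (P.hasFDerivAt_radialExt g.2 (P.sphere_ne_zero x))
  rw [← radialExt_add] at h
  rw [rotFun_apply]
  exact congrArg (fun F => F (P.rotGen k l x)) h.fderiv

lemma rotFun_smul (k l : Fin (P.d + 1)) (c : ℂ) (f : P.smoothAlg) :
    P.rotFun k l (c • f) = c • P.rotFun k l f := by
  refine P.smoothAlg_ext fun x => ?_
  have h := (P.hasFDerivAt_radialExt f.2 (P.sphere_ne_zero x)).const_smul c
  rw [← radialExt_smul] at h
  rw [rotFun_apply]
  exact congrArg (fun F => F (P.rotGen k l x)) h.fderiv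

lemma rotFun_mul (k l : Fin (P.d + 1)) (f g : P.smoothAlg) :
    P.rotFun k l (f * g) = f * P.rotFun k l g + g * P.rotFun k l f := by
  refine P.smoothAlg_ext fun x => ?_
  have h := (P.hasFDerivAt_radialExt f.2 (P.sphere_ne_zero x)).mul
    (P.hasFDerivAt_radialExt g.2 (P.sphere_ne_zero x))
  rw [← radialExt_mul, radialExt_coe, radialExt_coe] at h
  rw [rotFun_apply]
  exact congrArg (fun F => F (P.rotGen k l x)) h.fderiv

/-- The vector field `x_l ∂/∂x_k - x_k ∂/∂x_l` as a derivation of the smooth functions. -/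
def rotDer (k l : Fin (P.d + 1)) : Derivation ℂ P.smoothAlg P.smoothAlg :=
  Derivation.mk'
    { toFun := P.rotFun k l
      map_add' := P.rotFun_add k l
      map_smul' := P.rotFun_smul k l }
    (P.rotFun_mul k l)

lemma rotDer_apply (k l : Fin (P.d + 1)) (f : P.smoothAlg) (x : P.Sphere) :
    (P.rotDer k l f).1 x = fderiv ℝ (P.radialExt f.1) x (P.rotGen k l x) := rfl

lemma hasDerivAt_comp_rot {k l : Fin (P.d + 1)} (hkl : k ≠ l) (f : P.smoothAlg) (θ : ℝ)
    (x : P.Sphere) : HasDerivAt (fun θ => f.1 (P.sphereMap (P.rot hkl θ) x))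
      ((P.rotDer k l f).1 (P.sphereMap (P.rot hkl θ) x)) θ := by
  have h := (P.hasFDerivAt_radialExt f.2
    (P.sphere_ne_zero (P.sphereMap (P.rot hkl θ) x))).comp_hasDerivAt θ
    (P.hasDerivAt_rotLin hkl θ x)
  rw [rotDer_apply]
  refine h.congr_of_eventuallyEq (.of_forall fun t => ?_)
  exact (P.radialExt_coe f.1 (P.sphereMap (P.rot hkl t) x)).symm

lemma sphereMap_rot_zero {k l : Fin (P.d + 1)} (hkl : k ≠ l) (x : P.Sphere) :
    P.sphereMap (P.rot hkl 0) x = x := by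
  ext1; exact P.rotLin_zero k l x

/-- The coordinate functions as smooth functions. -/
def coordS (k : Fin (P.d + 1)) : P.smoothAlg := ⟨P.coord k, P.coord_mem k⟩

@[simp] lemma rotDer_self (k : Fin (P.d + 1)) (f : P.smoothAlg) : P.rotDer k k f = 0 := by
  refine P.smoothAlg_ext fun x => ?_
  rw [rotDer_apply, rotGen_apply]
  simp

lemma rotDer_swap (k l : Fin (P.d + 1)) (f : P.smoothAlg) :
    P.rotDer l k f = - P.rotDer k l f := by
  refine P.smoothAlg_ext fun x => ?_
  change (P.rotDer l k f).1 x = - (P.rotDer k l f).1 x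
  rw [rotDer_apply, rotDer_apply, ← map_neg, rotGen_apply, rotGen_apply, neg_sub]

lemma rotDer_coordS (k l i : Fin (P.d + 1)) : P.rotDer k l (P.coordS i) =
    (if i = k then P.coordS l else 0) - (if i = l then P.coordS k else 0) := by
  by_cases hkl : k = l
  · subst hkl; simp
  refine P.smoothAlg_ext fun x => ?_
  have h1 := P.hasDerivAt_comp_rot hkl (P.coordS i) 0 x
  rw [sphereMap_rot_zero] at h1
  have h2 : HasDerivAt (fun θ => ((P.rotLin k l θ x i : ℝ) : ℂ)) _ 0 :=
    ((EuclideanSpace.proj (𝕜 := ℝ) i).hasFDerivAt.comp_hasDerivAt 0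
      (P.hasDerivAt_rotLin hkl 0 x)).ofReal_comp
  have h3 := h1.unique h2
  change (P.rotDer k l (P.coordS i)).1 x = _
  rw [h3, rotLin_zero, rotGen_apply]
  split_ifs with h4 h5 h5
  · exact absurd (h4.symm.trans h5) hkl
  all_goals simp [h4, h5, coordS, coord, hkl, Ne.symm hkl]

/-- The operator `J̃²` on smooth functions. -/
def lap : P.smoothAlg →ₗ[ℂ] P.smoothAlg :=
  -∑ k, ∑ l ∈ Finset.Ioi k, (P.rotDer k l).toLinearMap ∘ₗ (P.rotDer k l).toLinearMap

lemma lap_apply (f : P.smoothAlg) :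
    P.lap f = -∑ k, ∑ l ∈ Finset.Ioi k, P.rotDer k l (P.rotDer k l f) := by
  simp [lap]

lemma J_eq (k l : Fin (P.d + 1)) (f : P.smoothAlg) :
    P.J k l f.1 = (-Complex.I * P.hbar) • ⇑(P.rotDer k l f).1 := by
  funext x
  simp [J, rotDer_apply, rotGen_apply]

lemma JsqTilde_eq (f : P.smoothAlg) (x : P.Sphere) : P.JsqTilde f.1 x = (P.lap f).1 x := by
  have h0 : (P.hbar : ℂ) ≠ 0 := by exact_mod_cast P.hbar_pos.ne'
  have h (k l) : P.J k l (P.J k l f.1) x =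
      -(P.hbar : ℂ) ^ 2 * (P.rotDer k l (P.rotDer k l f)).1 x := by
    rw [J_eq]
    have := P.J_eq k l ((-Complex.I * P.hbar) • P.rotDer k l f)
    refine (congrFun this x).trans ?_
    simp
    ring_nf
    simp
  rw [JsqTilde, Jsq, lap_apply]
  simp only [h, ← Finset.mul_sum]
  have h2 : (-∑ k, ∑ l ∈ Finset.Ioi k, P.rotDer k l (P.rotDer k l f) : P.smoothAlg).1 x =
      -∑ k, ∑ l ∈ Finset.Ioi k, (P.rotDer k l (P.rotDer k l f)).1 x := by
    simp
  rw [h2]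
  field_simp

/-! ### Symmetry of `J̃²` -/

lemma inner_toL2 (f g : C(P.Sphere, ℂ)) :
    inner ℂ (P.toL2 f) (P.toL2 g) = ∫ x, g x * conj (f x) ∂P.surfaceMeasure :=
  ContinuousMap.inner_toLp P.surfaceMeasure f g

/-- The integral of f over the rotated sphere does not depend on the angle; differentiate under the
integral sign at angle 0. -/
lemma integral_rotDer (k l : Fin (P.d + 1)) (f : P.smoothAlg) :
    ∫ x, (P.rotDer k l f).1 x ∂P.surfaceMeasure = 0 := by
  by_cases hkl : k = l
  · subst hkl; simp
  have h := hasDerivAt_integral_of_dominated_loc_of_deriv_le (μ := P.surfaceMeasure) (𝕜 := ℝ)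
    (F := fun θ x => f.1 (P.sphereMap (P.rot hkl θ) x))
    (F' := fun θ x => (P.rotDer k l f).1 (P.sphereMap (P.rot hkl θ) x)) (x₀ := 0)
    (bound := fun _ => ‖(P.rotDer k l f).1‖) (s := Set.univ) Filter.univ_mem
    (.of_forall fun θ => (f.1.comp (P.sphereMap (P.rot hkl θ))).continuous.aestronglyMeasurable)
    (P.integrable_continuousMap (f.1.comp (P.sphereMap (P.rot hkl 0))))
    (((P.rotDer k l f).1.comp (P.sphereMap (P.rot hkl 0))).continuous.aestronglyMeasurable)
    (.of_forall fun x θ _ => ContinuousMap.norm_coe_le_norm _ _)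
    (integrable_const _) (.of_forall fun x θ _ => P.hasDerivAt_comp_rot hkl f θ x)
  have h1 := h.2
  simp only [integral_comp_sphereMap] at h1
  exact h1.unique (hasDerivAt_const 0 _)

/-- Complex conjugation of smooth functions. -/
def starS (f : P.smoothAlg) : P.smoothAlg := ⟨star f.1, P.star_mem f.2⟩

lemma rotDer_starS (k l : Fin (P.d + 1)) (f : P.smoothAlg) :
    P.rotDer k l (P.starS f) = P.starS (P.rotDer k l f) := by
  by_cases hkl : k = l
  · subst hkl; refine P.smoothAlg_ext fun x => ?_; simp [starS]
  refine P.smoothAlg_ext fun x => ?_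
  have h1 := P.hasDerivAt_comp_rot hkl (P.starS f) 0 x
  have h2 := (P.hasDerivAt_comp_rot hkl f 0 x).star
  rw [sphereMap_rot_zero] at h1 h2
  exact h1.unique h2

/-- The vector of the Hilbert space given by a smooth function. -/
def toL2S : P.smoothAlg →ₗ[ℂ] P.Hilb := P.toL2.toLinearMap ∘ₗ P.smoothAlg.val.toLinearMap

lemma toL2S_apply (f : P.smoothAlg) : P.toL2S f = P.toL2 f.1 := rfl

/-- Integration by parts: the rotational derivative of the product of conj f and g integrates to
zero. -/
lemma inner_rotDer (k l : Fin (P.d + 1)) (f g : P.smoothAlg) :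
    inner ℂ (P.toL2S (P.rotDer k l f)) (P.toL2S g) =
      -inner ℂ (P.toL2S f) (P.toL2S (P.rotDer k l g)) := by
  rw [eq_neg_iff_add_eq_zero, toL2S_apply, toL2S_apply, toL2S_apply, toL2S_apply, inner_toL2,
    inner_toL2, ← integral_add]
  · rw [← P.integral_rotDer k l (P.starS f * g)]
    refine integral_congr_ae (.of_forall fun x => ?_)
    rw [Derivation.leibniz, rotDer_starS]
    simp [starS]
    ring
  · exact P.integrable_continuousMap (g.1 * star (P.rotDer k l f).1)
  · exact P.integrable_continuousMap ((P.rotDer k l g).1 * star f.1)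

lemma inner_lap (f g : P.smoothAlg) :
    inner ℂ (P.toL2S (P.lap f)) (P.toL2S g) = inner ℂ (P.toL2S f) (P.toL2S (P.lap g)) := by
  simp [lap_apply, sum_inner, inner_sum, inner_rotDer]

/-! ### Polynomials in given elements of an algebra -/

section Abstract

variable {ι A : Type*} [CommRing A] [Algebra ℂ A] (x : ι → A)

/-- The polynomials of degree at most `n` in the elements `x i` of an algebra. -/
def polySpan (n : ℕ) : Submodule ℂ A := Submodule.span ℂ (insert 1 (Set.range x)) ^ n

lemma mul_mem_polySpan {n : ℕ} (i : ι) {f : A} (hf : f ∈ polySpan x n) :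
    x i * f ∈ polySpan x (n + 1) := by
  rw [polySpan, pow_succ']
  exact Submodule.mul_mem_mul
    (Submodule.subset_span (Set.mem_insert_of_mem _ (Set.mem_range_self i))) hf

lemma polySpan_le_succ (n : ℕ) : polySpan x n ≤ polySpan x (n + 1) := by
  intro f hf
  rw [polySpan, pow_succ', ← one_mul f]
  exact Submodule.mul_mem_mul (Submodule.subset_span (Set.mem_insert _ _)) hf

lemma polySpan_mono : Monotone (polySpan x) := monotone_nat_of_le_succ (polySpan_le_succ x)

lemma mem_polySpan_zero {f : A} : f ∈ polySpan x 0 ↔ ∃ c, algebraMap ℂ A c = f := by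
  rw [polySpan, pow_zero, Submodule.mem_one]

/-- Induction over the polynomials of degree at most `n + 1`. -/
lemma polySpan_succ_le {n : ℕ} {S : Submodule ℂ A} (h0 : polySpan x n ≤ S)
    (h1 : ∀ f ∈ polySpan x n, ∀ i, x i * f ∈ S) : polySpan x (n + 1) ≤ S := by
  rw [polySpan, pow_succ', Submodule.mul_le]
  intro m hm f hf
  induction hm using Submodule.span_induction with
  | mem y hy =>
    rcases hy with rfl | ⟨i, rfl⟩
    · rw [one_mul]; exact h0 hf
    · exact h1 f hf i
  | zero => simp
  | add x y _ _ hx hy => rw [add_mul]; exact S.add_mem hx hy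
  | smul c x _ hx => rw [smul_mul_assoc]; exact S.smul_mem c hx

lemma map_polySpan {B : Type*} [CommRing B] [Algebra ℂ B] (φ : A →ₐ[ℂ] B) (n : ℕ) :
    (polySpan x n).map φ.toLinearMap = polySpan (φ ∘ x) n := by
  rw [polySpan, polySpan, Submodule.map_pow, Submodule.map_span]
  congr 2
  simp [Set.image_insert_eq, Set.range_comp]

variable [Fintype ι] [LinearOrder ι] [LocallyFiniteOrderTop ι] [LocallyFiniteOrderBot ι]
  (D : ι → ι → Derivation ℂ A A)

/-- The second-order operator `-∑_{k<l} D_{kl}²`. -/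
def sqSum : A →ₗ[ℂ] A :=
  -∑ k, ∑ l ∈ Finset.Ioi k, (D k l).toLinearMap ∘ₗ (D k l).toLinearMap

/-- The derivation `∑_l x_l D_{il}`. -/
def gradDer (i : ι) : Derivation ℂ A A := ∑ l, x l • D i l

variable {x D}

omit [LocallyFiniteOrderBot ι] in
lemma sqSum_apply (f : A) : sqSum D f = -∑ k, ∑ l ∈ Finset.Ioi k, D k l (D k l f) := by
  simp [sqSum]

omit [LinearOrder ι] [LocallyFiniteOrderTop ι] [LocallyFiniteOrderBot ι] in
lemma gradDer_apply (i : ι) (f : A) : gradDer x D i f = ∑ l, x l * D i l f := by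
  have h := map_sum (Derivation.coeFnAddMonoidHom (R := ℂ) (A := A) (M := A))
    (fun l => x l • D i l) Finset.univ
  have h2 := congrFun h f
  rw [Finset.sum_apply] at h2
  exact h2

omit [Algebra ℂ A] in
-- Replaces the sum over k < l by half the sum over all ordered pairs, which is easier to
-- manipulate.
lemma two_mul_sum_Ioi (F : ι → ι → A) (h : ∀ k l, F k l = F l k) (h0 : ∀ k, F k k = 0) :
    2 * ∑ k, ∑ l ∈ Finset.Ioi k, F k l = ∑ k, ∑ l, F k l := by
  have h1 := Finset.sum_sum_Ioi_add_eq_sum_sum_off_diag F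
  have h2 : ∑ k, ∑ l, F k l = ∑ i, ∑ j ∈ {i}ᶜ, F j i := by
    refine Finset.sum_congr rfl fun k _ => ?_
    rw [← Finset.sum_compl_add_sum {k}]
    simp [h0, h k]
  rw [h2, ← h1]
  simp only [Finset.mul_sum]
  refine Finset.sum_congr rfl fun k _ => Finset.sum_congr rfl fun l _ => ?_
  rw [h l k]; ring

omit [LinearOrder ι] [LocallyFiniteOrderTop ι] [LocallyFiniteOrderBot ι] [Fintype ι] in
lemma two_mul_cancel {f g : A} (h : 2 * f = 2 * g) : f = g := by
  have h2 : (2 : ℂ) • f = (2 : ℂ) • g := by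
    simpa only [two_smul, two_mul] using h
  simpa [smul_smul] using congrArg (fun z => (2 : ℂ)⁻¹ • z) h2

variable (hswap : ∀ k l f, D l k f = -D k l f)
  (hx : ∀ k l i, D k l (x i) = (if i = k then x l else 0) - (if i = l then x k else 0))

include hswap

lemma two_mul_sqSum (f : A) : 2 * sqSum D f = -∑ k, ∑ l, D k l (D k l f) := by
  rw [sqSum_apply, mul_neg, two_mul_sum_Ioi]
  · intro k l
    rw [hswap k l f, map_neg, hswap k l, neg_neg]
  · intro k
    have : D k k (D k k f) = 0 := by
      apply two_mul_cancel
      linear_combination hswap k k (D k k f)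
    exact this

lemma sqSum_mul (f g : A) : sqSum D (f * g) = f * sqSum D g + g * sqSum D f -
    ∑ k, ∑ l, D k l f * D k l g := by
  apply two_mul_cancel
  rw [mul_sub, mul_add, mul_left_comm, two_mul_sqSum hswap, mul_left_comm 2 g,
    two_mul_sqSum hswap, two_mul_sqSum hswap]
  simp only [Derivation.leibniz, map_add, smul_eq_mul, Finset.mul_sum, mul_neg,
    ← Finset.sum_add_distrib, ← Finset.sum_sub_distrib, ← Finset.sum_neg_distrib]
  refine Finset.sum_congr rfl fun k _ => Finset.sum_congr rfl fun l _ => ?_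
  ring

include hx

omit [LocallyFiniteOrderTop ι] [LocallyFiniteOrderBot ι] in
-- The cross term of the product rule for J̃². For D_{kl} = x_l ∂_k - x_k ∂_l, `gradDer` is c ∂_i -
-- x_i ∑_l x_l ∂_l with c = ∑_l x_l², a multiple of the tangential gradient.
lemma sum_sum_mul_eq_gradDer (i : ι) (g : A) :
    ∑ k, ∑ l, D k l (x i) * D k l g = 2 * gradDer x D i g := by
  simp only [hx, sub_mul, Finset.sum_sub_distrib, ite_mul, zero_mul]
  rw [Finset.sum_comm]
  simp only [Finset.sum_ite_eq, Finset.mem_univ, if_true]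
  simp only [fun k => hswap i k g, gradDer_apply]
  simp only [mul_neg, Finset.sum_neg_distrib]
  ring

lemma sqSum_gen (i : ι) : sqSum D (x i) = ((Fintype.card ι : ℂ) - 1) • x i := by
  apply two_mul_cancel
  rw [two_mul_sqSum hswap]
  have h (k l) : D k l (D k l (x i)) =
      (if i = k then D k l (x l) else 0) - (if i = l then D k l (x k) else 0) := by
    rw [hx, map_sub]
    split_ifs <;> simp
  simp only [h, Finset.sum_sub_distrib]
  rw [Finset.sum_comm]
  simp only [Finset.sum_ite_eq, Finset.mem_univ, if_true]
  simp [hx, Finset.sum_sub_distrib, Algebra.smul_def]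
  ring

lemma sqSum_gen_mul (i : ι) (g : A) : sqSum D (x i * g) =
    x i * sqSum D g + ((Fintype.card ι : ℂ) - 1) • (x i * g) - (2 : ℂ) • gradDer x D i g := by
  rw [sqSum_mul hswap, sum_sum_mul_eq_gradDer hswap hx, sqSum_gen hswap hx, mul_smul_comm,
    mul_comm g, two_smul ℂ, two_mul]

variable {c : ℂ} (hsum : ∑ l, x l * x l = algebraMap ℂ A c)

omit hswap [LocallyFiniteOrderTop ι] [LocallyFiniteOrderBot ι] in
include hsum in
lemma gradDer_gen (i j : ι) : gradDer x D i (x j) =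
    (if j = i then algebraMap ℂ _ c else 0) - x i * x j := by
  rw [gradDer_apply]
  simp only [hx, mul_sub, Finset.sum_sub_distrib]
  congr 1
  · split_ifs <;> simp [hsum]
  · simp [mul_comm]

omit hswap [LocallyFiniteOrderTop ι] [LocallyFiniteOrderBot ι] in
include hsum in
-- The Euler part of `gradDer` acts on degree n as -n x_i to leading order, so adding n x_i f
-- cancels the part of degree n+1.
lemma gradDer_mem (n : ℕ) (i : ι) : ∀ f ∈ polySpan x n,
    gradDer x D i f + (n : ℂ) • (x i * f) ∈ polySpan x n := by
  induction n with
  | zero =>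
    intro f hf
    obtain ⟨c, rfl⟩ := (mem_polySpan_zero x).1 hf
    simp
  | succ n ih =>
    let T : A →ₗ[ℂ] A := (gradDer x D i).toLinearMap +
      ((n + 1 : ℕ) : ℂ) • LinearMap.mulLeft ℂ (x i)
    have hT (f : A) : T f = gradDer x D i f + ((n + 1 : ℕ) : ℂ) • (x i * f) := rfl
    suffices polySpan x (n + 1) ≤ (polySpan x (n + 1)).comap T from fun f hf => this hf
    refine polySpan_succ_le x (fun f hf => ?_) fun f hf j => ?_
    · have h : T f = (gradDer x D i f + (n : ℂ) • (x i * f)) + x i * f := by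
        rw [hT]; push_cast; module
      rw [Submodule.mem_comap, h]
      exact add_mem (polySpan_le_succ x n (ih f hf)) (mul_mem_polySpan x i hf)
    · have h : T (x j * f) = x j * (gradDer x D i f + (n : ℂ) • (x i * f)) +
          (if j = i then c else 0) • f := by
        rw [hT, Derivation.leibniz, gradDer_gen hx hsum]
        split_ifs <;> simp [Algebra.smul_def] <;> ring
      rw [Submodule.mem_comap, h]
      exact add_mem (mul_mem_polySpan x j (ih f hf))
        (Submodule.smul_mem _ _ (polySpan_le_succ x n hf))

omit hswap hx [LocallyFiniteOrderBot ι] in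
lemma sqSum_of_mem_zero {f : A} (hf : f ∈ polySpan x 0) : sqSum D f = 0 := by
  obtain ⟨c, rfl⟩ := (mem_polySpan_zero x).1 hf
  simp [sqSum_apply]

include hsum in
-- With N the number of variables, let f have degree n+1. Passing from f to x_i f adds N-1 from
-- `sqSum_gen_mul` and 2(n+1) from the leading part of `gradDer`. Their sum is exactly the increment
-- from (n+1)(n+N-1) to (n+2)(n+N).
lemma sqSum_sub_mem (n : ℕ) : ∀ f ∈ polySpan x (n + 1),
    sqSum D f - (((n + 1 : ℕ) : ℂ) * (n + Fintype.card ι - 1)) • f ∈ polySpan x n := by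
  induction n with
  | zero =>
    let T : A →ₗ[ℂ] A := sqSum D - ((Fintype.card ι : ℂ) - 1) • LinearMap.id
    have hT (f : A) : T f = sqSum D f - ((Fintype.card ι : ℂ) - 1) • f := rfl
    suffices polySpan x 1 ≤ (polySpan x 0).comap T by
      intro f hf
      have := this hf
      rw [Submodule.mem_comap, hT] at this
      simpa using this
    refine polySpan_succ_le x (fun f hf => ?_) fun f hf i => ?_
    · rw [Submodule.mem_comap, hT, sqSum_of_mem_zero hf, zero_sub]
      exact neg_mem (Submodule.smul_mem _ _ hf)
    · obtain ⟨c, rfl⟩ := (mem_polySpan_zero x).1 hf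
      have : T (x i * algebraMap ℂ _ c) = 0 := by
        simp [hT, sqSum_gen_mul hswap hx, sqSum_of_mem_zero hf]
      rw [Submodule.mem_comap, this]
      exact zero_mem _
  | succ n ih =>
    let T : A →ₗ[ℂ] A :=
      sqSum D - (((n + 2 : ℕ) : ℂ) * ((n + 1 : ℕ) + Fintype.card ι - 1)) • LinearMap.id
    have hT (f : A) : T f =
      sqSum D f - (((n + 2 : ℕ) : ℂ) * ((n + 1 : ℕ) + Fintype.card ι - 1)) • f := rfl
    suffices polySpan x (n + 2) ≤ (polySpan x (n + 1)).comap T from fun f hf => this hf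
    refine polySpan_succ_le x (fun f hf => ?_) fun f hf i => ?_
    · have : T f = (sqSum D f - (((n + 1 : ℕ) : ℂ) * (n + Fintype.card ι - 1)) • f) +
          ((((n + 1 : ℕ) : ℂ) * (n + Fintype.card ι - 1)) -
          (((n + 2 : ℕ) : ℂ) * ((n + 1 : ℕ) + Fintype.card ι - 1))) • f := by
        rw [hT]; module
      rw [Submodule.mem_comap, this]
      exact add_mem (polySpan_le_succ x n (ih f hf)) (Submodule.smul_mem _ _ hf)
    · have : T (x i * f) =
          x i * (sqSum D f - (((n + 1 : ℕ) : ℂ) * (n + Fintype.card ι - 1)) • f) -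
          (2 : ℂ) • (gradDer x D i f + ((n + 1 : ℕ) : ℂ) • (x i * f)) := by
        rw [hT, sqSum_gen_mul hswap hx, mul_sub (x i), mul_smul_comm]
        push_cast
        module
      rw [Submodule.mem_comap, this]
      exact sub_mem (mul_mem_polySpan x i (ih f hf))
        (Submodule.smul_mem _ _ (gradDer_mem hx hsum (n + 1) i f hf))

end Abstract

/-! ### `J̃²` on polynomials -/

lemma sum_coordS_sq : ∑ l, P.coordS l * P.coordS l = algebraMap ℂ _ ((P.r : ℂ) ^ 2) := by
  refine P.smoothAlg_ext fun x => ?_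
  have h := (P.ofReal x).2
  have h2 : (∑ l, P.coordS l * P.coordS l : P.smoothAlg).1 x =
      ∑ l, P.coord l x * P.coord l x := by simp [coordS]
  rw [h2]
  simp only [← sq]
  exact h

/-- The eigenvalues `n (n + d - 1)` of `J̃²`. -/
def ev (n : ℕ) : ℝ := n * (n + P.d - 1)

/-- The polynomial functions of degree at most `n` on the sphere. -/
def polyFns (n : ℕ) : Submodule ℂ P.smoothAlg := polySpan P.coordS n

lemma lap_of_mem_zero {f : P.smoothAlg} (hf : f ∈ P.polyFns 0) : P.lap f = 0 :=
  sqSum_of_mem_zero hf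

lemma lap_sub_mem (n : ℕ) (f : P.smoothAlg) (hf : f ∈ P.polyFns (n + 1)) :
    P.lap f - (P.ev (n + 1) : ℂ) • f ∈ P.polyFns n := by
  have h := sqSum_sub_mem (fun k l f => P.rotDer_swap k l f) P.rotDer_coordS P.sum_coordS_sq n f hf
  convert! h using 3
  simp [ev]
  ring_nf
  simp

/-! ### Spherical harmonics -/

lemma toL2S_injective : Function.Injective P.toL2S := fun _ _ h =>
  Subtype.ext (ContinuousMap.toLp_injective P.surfaceMeasure h)

lemma polyFns_mono : Monotone P.polyFns := polySpan_mono _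

lemma mul_mem_polyFns {m n : ℕ} {f g : P.smoothAlg} (hf : f ∈ P.polyFns m)
    (hg : g ∈ P.polyFns n) : f * g ∈ P.polyFns (m + n) := by
  rw [polyFns, polySpan, pow_add]
  exact Submodule.mul_mem_mul hf hg

lemma algebraMap_mem_polyFns (c : ℂ) : algebraMap ℂ _ c ∈ P.polyFns 0 :=
  (mem_polySpan_zero _).2 ⟨c, rfl⟩

lemma coordS_mem_polyFns (i : Fin (P.d + 1)) : P.coordS i ∈ P.polyFns 1 := by
  have h := mul_mem_polySpan P.coordS i (P.algebraMap_mem_polyFns 1)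
  rwa [map_one, mul_one] at h

lemma lap_mem {n : ℕ} {f : P.smoothAlg} (hf : f ∈ P.polyFns n) : P.lap f ∈ P.polyFns n := by
  cases n with
  | zero => rw [P.lap_of_mem_zero hf]; exact zero_mem _
  | succ n =>
    have h := add_mem (P.polyFns_mono n.le_succ (P.lap_sub_mem n f hf))
      (Submodule.smul_mem _ (P.ev (n + 1) : ℂ) hf)
    simpa using h

lemma starS_mem {n : ℕ} {f : P.smoothAlg} (hf : f ∈ P.polyFns n) : P.starS f ∈ P.polyFns n := by
  -- Although conjugation is only antilinear, its preimage of a complex subspace is a complex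
  -- subspace, so `polySpan_succ_le` applies.
  let S (n : ℕ) : Submodule ℂ P.smoothAlg :=
    { carrier := {f | P.starS f ∈ P.polyFns n}
      zero_mem' := by
        have : P.starS 0 = 0 := Subtype.ext (star_zero _)
        change P.starS 0 ∈ P.polyFns n
        rw [this]; exact zero_mem _
      add_mem' := fun {f g} hf hg => by
        have : P.starS (f + g) = P.starS f + P.starS g := Subtype.ext (star_add _ _)
        change P.starS (f + g) ∈ P.polyFns n
        rw [this]; exact add_mem hf hg
      smul_mem' := fun c f hf => by
        have : P.starS (c • f) = star c • P.starS f := Subtype.ext (star_smul _ _)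
        change P.starS (c • f) ∈ P.polyFns n
        rw [this]; exact Submodule.smul_mem _ _ hf }
  suffices h : ∀ n, P.polyFns n ≤ S n from h n hf
  intro n
  induction n with
  | zero =>
    intro f hf
    obtain ⟨c, rfl⟩ := (mem_polySpan_zero _).1 hf
    have : P.starS (algebraMap ℂ _ c) = algebraMap ℂ _ (star c) := rfl
    change P.starS (algebraMap ℂ _ c) ∈ P.polyFns 0
    rw [this]
    exact P.algebraMap_mem_polyFns _
  | succ n ih =>
    refine polySpan_succ_le _ (fun f hf => P.polyFns_mono n.le_succ (ih hf)) fun f hf i => ?_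
    have : P.starS (P.coordS i * f) = P.coordS i * P.starS f := by
      refine P.smoothAlg_ext fun x => ?_
      simp [starS, coordS, coord]
    change P.starS (P.coordS i * f) ∈ P.polyFns (n + 1)
    rw [this]
    exact mul_mem_polySpan _ i (ih hf)

/-- The subspace of the Hilbert space of the polynomial functions of degree at most `n`. -/
def polyL2 (n : ℕ) : Submodule ℂ P.Hilb := (P.polyFns n).map P.toL2S

instance (n : ℕ) : FiniteDimensional ℂ (P.polyFns n) :=
  Module.Finite.iff_fg.2 ((Submodule.fg_span ((Set.finite_range _).insert _)).pow n)

instance (n : ℕ) : FiniteDimensional ℂ (P.polyL2 n) := by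
  unfold polyL2; infer_instance

lemma polyL2_mono : Monotone P.polyL2 := fun _ _ h => Submodule.map_mono (P.polyFns_mono h)

/-- The spherical harmonics of degree `n`. -/
def harm : ℕ → Submodule ℂ P.Hilb
  | 0 => P.polyL2 0
  | n + 1 => (P.polyL2 n)ᗮ ⊓ P.polyL2 (n + 1)

lemma harm_le (n : ℕ) : P.harm n ≤ P.polyL2 n := by
  cases n with
  | zero => exact le_rfl
  | succ n => exact inf_le_right

instance (n : ℕ) : FiniteDimensional ℂ (P.harm n) :=
  Submodule.finiteDimensional_of_le (P.harm_le n)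

lemma polyL2_le_of_harm_le {n : ℕ} {S : Submodule ℂ P.Hilb} (h : ∀ m ≤ n, P.harm m ≤ S) :
    P.polyL2 n ≤ S := by
  induction n with
  | zero => exact h 0 le_rfl
  | succ n ih =>
    rw [← Submodule.sup_orthogonal_inf_of_hasOrthogonalProjection (P.polyL2_mono n.le_succ)]
    exact sup_le (ih fun m hm => h m (by omega)) (h (n + 1) le_rfl)

lemma inner_eq_zero_of_lt {m n : ℕ} (h : m < n) {φ χ : P.Hilb} (hφ : φ ∈ P.polyL2 m)
    (hχ : χ ∈ P.harm n) : inner ℂ φ χ = 0 := by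
  obtain ⟨k, rfl⟩ : ∃ k, n = k + 1 := ⟨n - 1, by omega⟩
  exact hχ.1 _ (P.polyL2_mono (Nat.lt_succ_iff.1 h) hφ)

lemma inner_harm_of_ne {m n : ℕ} (h : m ≠ n) {φ χ : P.Hilb} (hφ : φ ∈ P.harm m)
    (hχ : χ ∈ P.harm n) : inner ℂ φ χ = 0 := by
  rcases h.lt_or_gt with h | h
  · exact P.inner_eq_zero_of_lt h (P.harm_le m hφ) hχ
  · rw [← inner_conj_symm, P.inner_eq_zero_of_lt h (P.harm_le n hχ) hφ, map_zero]

/-- The defect g = J̃²f - λf has lower degree, and so has J̃²g; both are orthogonal to f. By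
symmetry ⟨g, g⟩ = ⟨J̃²g, f⟩ - λ⟨g, f⟩ = 0. -/
lemma exists_of_mem_harm {n : ℕ} {φ : P.Hilb} (hφ : φ ∈ P.harm n) :
    ∃ f ∈ P.polyFns n, P.toL2S f = φ ∧ P.lap f = (P.ev n : ℂ) • f := by
  obtain ⟨f, hf, rfl⟩ := P.harm_le n hφ
  refine ⟨f, hf, rfl, ?_⟩
  cases n with
  | zero => simp [ev, P.lap_of_mem_zero hf]
  | succ n =>
    have hg := P.lap_sub_mem n f hf
    set g := P.lap f - (P.ev (n + 1) : ℂ) • f with hgdef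
    have h0 (h : P.smoothAlg) (hh : h ∈ P.polyFns n) : inner ℂ (P.toL2S h) (P.toL2S f) = 0 :=
      P.inner_eq_zero_of_lt n.lt_succ_self ⟨h, hh, rfl⟩ hφ
    have h1 : inner ℂ (P.toL2S g) (P.toL2S g) = 0 := by
      have hE : P.toL2S g = P.toL2S (P.lap f) - (P.ev (n + 1) : ℂ) • P.toL2S f := by
        rw [hgdef, map_sub, map_smul]
      rw [show inner ℂ (P.toL2S g) (P.toL2S g) = inner ℂ (P.toL2S g) _ from congrArg _ hE,
        inner_sub_right, inner_smul_right, ← inner_lap, h0 _ (P.lap_mem hg), h0 _ hg]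
      simp
    have h2 : g = 0 := P.toL2S_injective (by simpa using inner_self_eq_zero.1 h1)
    exact sub_eq_zero.1 h2

/-- Stone–Weierstrass: the polynomials form a conjugation-invariant algebra separating points, hence
are dense in the continuous functions and then in L². -/
lemma eq_zero_of_orthogonal {φ : P.Hilb} (h : ∀ n, ∀ χ ∈ P.harm n, inner ℂ χ φ = 0) : φ = 0 := by
  have h1 (n : ℕ) (f : P.smoothAlg) (hf : f ∈ P.polyFns n) : inner ℂ (P.toL2S f) φ = 0 := by
    have : P.polyL2 n ≤ (ℂ ∙ φ)ᗮ := P.polyL2_le_of_harm_le fun m _ χ hχ =>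
      (Submodule.mem_orthogonal_singleton_iff_inner_left).2 (h m χ hχ)
    exact (Submodule.mem_orthogonal_singleton_iff_inner_left).1 (this ⟨f, hf, rfl⟩)
  let A : StarSubalgebra ℂ C(P.Sphere, ℂ) := StarAlgebra.adjoin ℂ (Set.range P.coord)
  have hA (g : C(P.Sphere, ℂ)) (hg : g ∈ A) : ∃ n, ∃ f ∈ P.polyFns n, f.1 = g := by
    induction hg using StarAlgebra.adjoin_induction with
    | mem x hx =>
      obtain ⟨i, rfl⟩ := hx
      exact ⟨1, _, P.coordS_mem_polyFns i, rfl⟩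
    | algebraMap c => exact ⟨0, _, P.algebraMap_mem_polyFns c, rfl⟩
    | add x y _ _ hx hy =>
      obtain ⟨m, f, hf, rfl⟩ := hx
      obtain ⟨n, g, hg, rfl⟩ := hy
      exact ⟨max m n, f + g, add_mem (P.polyFns_mono (le_max_left _ _) hf)
        (P.polyFns_mono (le_max_right _ _) hg), rfl⟩
    | mul x y _ _ hx hy =>
      obtain ⟨m, f, hf, rfl⟩ := hx
      obtain ⟨n, g, hg, rfl⟩ := hy
      exact ⟨m + n, f * g, P.mul_mem_polyFns hf hg, rfl⟩
    | star x _ hx =>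
      obtain ⟨m, f, hf, rfl⟩ := hx
      exact ⟨m, P.starS f, P.starS_mem hf, rfl⟩
  have hsep : A.SeparatesPoints := by
    intro x y hxy
    by_contra! hcon
    apply hxy
    ext i
    have := hcon (P.coord i) ⟨P.coord i, StarAlgebra.subset_adjoin _ _ ⟨i, rfl⟩, rfl⟩
    simpa [coord] using this
  have hdense := ContinuousMap.starSubalgebra_topologicalClosure_eq_top_of_separatesPoints A hsep
  have hcont : Continuous fun g : C(P.Sphere, ℂ) => inner ℂ (P.toL2 g) φ := by fun_prop
  have h2 (g : C(P.Sphere, ℂ)) : inner ℂ (P.toL2 g) φ = 0 := by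
    have hg : g ∈ closure (A : Set C(P.Sphere, ℂ)) := by
      rw [← StarSubalgebra.topologicalClosure_coe, hdense]; trivial
    refine closure_minimal (t := {g | inner ℂ (P.toL2 g) φ = 0}) (fun g hg => ?_)
      (isClosed_eq hcont continuous_const) hg
    obtain ⟨n, f, hf, rfl⟩ := hA g hg
    exact h1 n f hf
  have h3 : inner ℂ φ φ = 0 := by
    have hd : DenseRange P.toL2 := ContinuousMap.toLp_denseRange ℂ P.surfaceMeasure ℂ (by simp)
    exact hd.induction_on (p := fun χ => inner ℂ χ φ = 0) φ
      (isClosed_eq (by fun_prop) continuous_const) h2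
  exact inner_self_eq_zero.1 h3

/-! ### Projections onto the harmonics and identification of the eigenspaces of J̃². -/

lemma ev_strictMono : StrictMono P.ev := by
  refine strictMono_nat_of_lt_succ fun n => ?_
  have h : (1 : ℝ) ≤ P.d := by exact_mod_cast P.one_le_d
  have hn : (0 : ℝ) ≤ n := n.cast_nonneg
  simp only [ev]
  push_cast
  nlinarith

/-- The orthogonal projection onto the spherical harmonics of degree `n`. -/
def Q (n : ℕ) : P.Hilb →L[ℂ] P.Hilb := (P.harm n).starProjection

lemma Q_mem (n : ℕ) (φ : P.Hilb) : P.Q n φ ∈ P.harm n := Submodule.starProjection_apply_mem _ _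

lemma Q_of_mem {n : ℕ} {φ : P.Hilb} (hφ : φ ∈ P.harm n) : P.Q n φ = φ :=
  Submodule.starProjection_eq_self_iff.2 hφ

lemma Q_eq_zero {n : ℕ} {φ : P.Hilb} (h : ∀ χ ∈ P.harm n, inner ℂ χ φ = 0) : P.Q n φ = 0 :=
  (Submodule.starProjection_apply_eq_zero_iff _).2 h

lemma Q_of_mem_ne {m n : ℕ} (h : m ≠ n) {φ : P.Hilb} (hφ : φ ∈ P.harm m) : P.Q n φ = 0 :=
  P.Q_eq_zero fun _ hχ => P.inner_harm_of_ne h.symm hχ hφ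

lemma inner_Q (n : ℕ) (φ χ : P.Hilb) : inner ℂ (P.Q n φ) χ = inner ℂ φ (P.Q n χ) :=
  Submodule.inner_starProjection_left_eq_right _ _ _

lemma inner_Q_of_mem {n : ℕ} {φ : P.Hilb} (hφ : φ ∈ P.harm n) (χ : P.Hilb) :
    inner ℂ φ (P.Q n χ) = inner ℂ φ χ := by
  rw [← inner_Q, P.Q_of_mem hφ]

lemma norm_Q_le (n : ℕ) (φ : P.Hilb) : ‖P.Q n φ‖ ≤ ‖φ‖ :=
  Submodule.norm_starProjection_apply_le _ _

/-- Eigenfunctions of a symmetric operator for different eigenvalues are orthogonal; here f is any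
smooth eigenfunction, not yet known to be a polynomial. -/
lemma inner_eq_zero_of_eigen {lam : ℝ} {f : C(P.Sphere, ℂ)} (hf : f ∈ P.Smooth)
    (h : ∀ x, P.JsqTilde f x = (lam : ℂ) * f x) {n : ℕ} (hn : P.ev n ≠ lam) {χ : P.Hilb}
    (hχ : χ ∈ P.harm n) : inner ℂ χ (P.toL2 f) = 0 := by
  obtain ⟨g, -, rfl, hg⟩ := P.exists_of_mem_harm hχ
  let f' : P.smoothAlg := ⟨f, hf⟩
  have hf' : P.lap f' = (lam : ℂ) • f' :=
    P.smoothAlg_ext fun x => (P.JsqTilde_eq f' x).symm.trans (h x)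
  have h1 := P.inner_lap g f'
  rw [hg, hf', map_smul, map_smul, inner_smul_left, inner_smul_right, Complex.conj_ofReal,
    ← sub_eq_zero, ← sub_mul] at h1
  refine (mul_eq_zero.1 h1).resolve_left ?_
  rw [← Complex.ofReal_sub]
  exact_mod_cast sub_ne_zero.2 hn

/-- For a smooth eigenfunction f, the remainder f - Q_n f is orthogonal to every `harm m`, so it
vanishes by completeness. -/
lemma eigenspace_ev (n : ℕ) : P.eigenspace (P.ev n) = P.harm n := by
  apply le_antisymm
  · refine Submodule.span_le.2 ?_
    rintro _ ⟨f, hf, h, rfl⟩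
    have h0 : P.toL2 f - P.Q n (P.toL2 f) = 0 := by
      refine P.eq_zero_of_orthogonal fun m χ hχ => ?_
      rw [inner_sub_right]
      by_cases hm : m = n
      · subst hm
        rw [P.inner_Q_of_mem hχ, sub_self]
      · rw [P.inner_eq_zero_of_eigen hf h (P.ev_strictMono.injective.ne hm) hχ,
          P.inner_harm_of_ne hm hχ (P.Q_mem n _), sub_self]
    rw [sub_eq_zero.1 h0]
    exact P.Q_mem n _
  · intro φ hφ
    obtain ⟨f, -, rfl, hf⟩ := P.exists_of_mem_harm hφ
    refine Submodule.subset_span ⟨f.1, f.2, fun x => ?_, rfl⟩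
    rw [JsqTilde_eq, hf]
    rfl

lemma eigenspace_of_ne {lam : ℝ} (hlam : lam ∉ Set.range P.ev) : P.eigenspace lam = ⊥ := by
  rw [eigenspace, Submodule.span_eq_bot]
  rintro _ ⟨f, hf, h, rfl⟩
  exact P.eq_zero_of_orthogonal fun m χ hχ =>
    P.inner_eq_zero_of_eigen hf h (fun h' => hlam ⟨m, h'⟩) hχ

lemma starProjection_congr {K L : Submodule ℂ P.Hilb} [K.HasOrthogonalProjection]
    [L.HasOrthogonalProjection] (h : K = L) : K.starProjection = L.starProjection := by
  subst h; rfl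

lemma proj_ev (n : ℕ) : P.proj (P.ev n) = P.Q n := by
  apply starProjection_congr
  rw [eigenspace_ev]
  exact (Submodule.closed_of_finiteDimensional _).submodule_topologicalClosure_eq

lemma proj_of_ne {lam : ℝ} (hlam : lam ∉ Set.range P.ev) : P.proj lam = 0 := by
  have h : (P.eigenspace lam).topologicalClosure = ⊥ := by
    rw [P.eigenspace_of_ne hlam]
    exact (Submodule.closed_of_finiteDimensional _).submodule_topologicalClosure_eq
  rw [proj, P.starProjection_congr h]
  exact Submodule.starProjection_bot

/-! ### The exponentials of J̃² as series over degrees, and the decay of their factors. -/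

lemma expJ_eq (s : ℝ) (φ : P.Hilb) :
    P.expJ s φ = ∑' n, ((Real.exp (s * P.ev n) : ℝ) : ℂ) • P.Q n φ := by
  rw [expJ, ← P.ev_strictMono.injective.tsum_eq]
  · simp only [proj_ev]
  · intro lam hlam
    by_contra h
    exact hlam (by simp [P.proj_of_ne h])

lemma expJ_of_mem (s : ℝ) {n : ℕ} {φ : P.Hilb} (hφ : φ ∈ P.harm n) :
    P.expJ s φ = ((Real.exp (s * P.ev n) : ℝ) : ℂ) • φ := by
  rw [expJ_eq, tsum_eq_single n, P.Q_of_mem hφ]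
  intro m hm
  rw [P.Q_of_mem_ne hm.symm hφ, smul_zero]

lemma τ_pos : 0 < P.τ := by
  have := P.hbar_pos; have := P.m_pos; have := P.freq_pos; have := P.r_pos
  unfold τ; positivity

lemma sq_le_ev (n : ℕ) : (n : ℝ) ^ 2 ≤ P.ev n := by
  have h : (1 : ℝ) ≤ P.d := by exact_mod_cast P.one_le_d
  have hn : (0 : ℝ) ≤ n := n.cast_nonneg
  simp only [ev]
  nlinarith

/-- The factors `e^{-τ n(n+d-1)/2}`. -/
def decay (n : ℕ) : ℝ := Real.exp (-(P.τ / 2) * P.ev n)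

lemma decay_pos (n : ℕ) : 0 < P.decay n := Real.exp_pos _

/-- Since `ev n` is at least n², the term is at most (e^{-τn/2} K)^n, whose base tends to 0. This
absorbs every exponential growth in n below. -/
lemma summable_decay_mul_pow {K : ℝ} (hK : 0 ≤ K) : Summable fun n => P.decay n * K ^ n := by
  have hτ := P.τ_pos
  have ht : Filter.Tendsto (fun n : ℕ => Real.exp (-(P.τ / 2) * n) * K) Filter.atTop (nhds 0) := by
    rw [← zero_mul K]
    refine Filter.Tendsto.mul_const K (Real.tendsto_exp_atBot.comp ?_)
    exact tendsto_natCast_atTop_atTop.const_mul_atTop_of_neg (by linarith)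
  have he := ht.eventually_lt_const (show (0 : ℝ) < 1 / 2 by norm_num)
  refine Summable.of_norm_bounded_eventually_nat (g := fun n : ℕ => (1 / 2 : ℝ) ^ n)
    (summable_geometric_of_lt_one (by norm_num) (by norm_num)) ?_
  filter_upwards [he] with n hn
  have h1 : P.decay n ≤ Real.exp (-(P.τ / 2) * n) ^ n := by
    rw [← Real.exp_nat_mul, decay]
    apply Real.exp_le_exp.2
    have := P.sq_le_ev n
    nlinarith
  rw [Real.norm_of_nonneg (mul_nonneg (P.decay_pos n).le (pow_nonneg hK n))]
  calc P.decay n * K ^ n ≤ Real.exp (-(P.τ / 2) * n) ^ n * K ^ n := by gcongr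
    _ = (Real.exp (-(P.τ / 2) * n) * K) ^ n := (mul_pow _ _ _).symm
    _ ≤ _ := by gcongr

lemma hasSum_expJ (φ : P.Hilb) :
    HasSum (fun n => (P.decay n : ℂ) • P.Q n φ) (P.expJ (-(P.τ / 2)) φ) := by
  rw [expJ_eq]
  refine Summable.hasSum (f := fun n => (P.decay n : ℂ) • P.Q n φ) ?_
  refine Summable.of_norm_bounded (g := fun n => P.decay n * 1 ^ n * ‖φ‖)
    ((P.summable_decay_mul_pow zero_le_one).mul_right _) fun n => ?_
  rw [norm_smul, Complex.norm_real, Real.norm_of_nonneg (P.decay_pos n).le, one_pow, mul_one]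
  exact mul_le_mul_of_nonneg_left (P.norm_Q_le n φ) (P.decay_pos n).le

lemma Q_of_hasSum {F : ℕ → P.Hilb} {φ : P.Hilb} (hF : ∀ n, F n ∈ P.harm n) (h : HasSum F φ)
    (n : ℕ) : P.Q n φ = F n := by
  have h1 := h.mapL (P.Q n)
  refine h1.unique ?_
  have h2 := hasSum_single (f := fun m => P.Q n (F m)) n fun m hm => P.Q_of_mem_ne hm (hF m)
  simpa only [P.Q_of_mem (hF n)] using h2

lemma Q_expJ (φ : P.Hilb) (n : ℕ) :
    P.Q n (P.expJ (-(P.τ / 2)) φ) = (P.decay n : ℂ) • P.Q n φ :=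
  P.Q_of_hasSum (fun m => Submodule.smul_mem _ _ (P.Q_mem m φ)) (P.hasSum_expJ φ) n

end

end SphereParticle

namespace SphereParticle

noncomputable section

variable (P : SphereParticle)

/-! ### Polynomials on the complexified sphere -/

/-- The restriction of polynomials to the sphere. -/
def res : MvPolynomial (Fin (P.d + 1)) ℂ →ₐ[ℂ] P.smoothAlg := MvPolynomial.aeval P.coordS

lemma res_apply (p : MvPolynomial (Fin (P.d + 1)) ℂ) (x : P.Sphere) :
    (P.res p).1 x = MvPolynomial.eval (P.ofReal x).1 p := by
  induction p using MvPolynomial.induction_on with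
  | C c => simp [res]
  | add p q hp hq => rw [map_add, map_add, ← hp, ← hq]; rfl
  | mul_X p i hp =>
    rw [map_mul, map_mul, ← hp, MvPolynomial.eval_X, res, MvPolynomial.aeval_X]
    rfl

/-- The polynomials of degree at most `n`. -/
def polys (n : ℕ) : Submodule ℂ (MvPolynomial (Fin (P.d + 1)) ℂ) := polySpan MvPolynomial.X n

/-- The lift is not unique; `eval_eq_of_res_eq` shows that its values on the complexified sphere
are. -/
lemma exists_res_eq {n : ℕ} {f : P.smoothAlg} (hf : f ∈ P.polyFns n) :
    ∃ p ∈ P.polys n, P.res p = f := by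
  have h := map_polySpan (MvPolynomial.X (R := ℂ) (σ := Fin (P.d + 1))) P.res n
  have h2 : P.res ∘ MvPolynomial.X = P.coordS := by
    funext i; simp [res]
  rw [h2] at h
  have hf' : f ∈ (polySpan MvPolynomial.X n).map P.res.toLinearMap := h ▸ hf
  exact hf'

lemma res_mem {n : ℕ} {p : MvPolynomial (Fin (P.d + 1)) ℂ} (hp : p ∈ P.polys n) :
    P.res p ∈ P.polyFns n := by
  have h := map_polySpan (MvPolynomial.X (R := ℂ) (σ := Fin (P.d + 1))) P.res n
  have h2 : P.res ∘ MvPolynomial.X = P.coordS := by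
    funext i; simp [res]
  rw [h2] at h
  rw [polyFns, ← h]
  exact Submodule.mem_map_of_mem (f := P.res.toLinearMap) hp

/-- The complexification of the great circle through the orthonormal vectors `e₁`, `e₂`. -/
def circle (e₁ e₂ : P.Ambient) (z : ℂ) : Fin (P.d + 1) → ℂ :=
  fun k => P.r * (Complex.cos z * e₁ k + Complex.sin z * e₂ k)

variable {P}

lemma sum_circle_sq {e₁ e₂ : P.Ambient} (h₁ : ‖e₁‖ = 1) (h₂ : ‖e₂‖ = 1)
    (h : inner ℝ e₁ e₂ = 0) (z : ℂ) : ∑ k, P.circle e₁ e₂ z k ^ 2 = (P.r : ℂ) ^ 2 := by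
  have h1 : ∑ k, e₁ k ^ 2 = 1 := by
    have := EuclideanSpace.real_norm_sq_eq e₁
    rw [← this, h₁, one_pow]
  have h2 : ∑ k, e₂ k ^ 2 = 1 := by
    have := EuclideanSpace.real_norm_sq_eq e₂
    rw [← this, h₂, one_pow]
  have h3 : ∑ k, e₁ k * e₂ k = 0 := by
    rw [← h, PiLp.inner_apply]
    exact Finset.sum_congr rfl fun k _ => by simp [mul_comm]
  have h1' : ∑ k, (e₁ k : ℂ) ^ 2 = 1 := by exact_mod_cast congrArg Complex.ofReal h1
  have h2' : ∑ k, (e₂ k : ℂ) ^ 2 = 1 := by exact_mod_cast congrArg Complex.ofReal h2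
  have h3' : ∑ k, (e₁ k : ℂ) * e₂ k = 0 := by exact_mod_cast congrArg Complex.ofReal h3
  have h4 : ∑ k, P.circle e₁ e₂ z k ^ 2 = (P.r : ℂ) ^ 2 * (Complex.cos z ^ 2 * ∑ k, (e₁ k : ℂ) ^ 2 +
      2 * Complex.cos z * Complex.sin z * ∑ k, (e₁ k : ℂ) * e₂ k +
      Complex.sin z ^ 2 * ∑ k, (e₂ k : ℂ) ^ 2) := by
    simp only [Finset.mul_sum, ← Finset.sum_add_distrib, circle]
    exact Finset.sum_congr rfl fun k _ => by ring
  rw [h4, h1', h2', h3']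
  linear_combination (P.r : ℂ) ^ 2 * Complex.sin_sq_add_cos_sq z

lemma exists_ofReal_circle {e₁ e₂ : P.Ambient} (h₁ : ‖e₁‖ = 1) (h₂ : ‖e₂‖ = 1)
    (h : inner ℝ e₁ e₂ = 0) (θ : ℝ) : ∃ x : P.Sphere, (P.ofReal x).1 = P.circle e₁ e₂ θ := by
  have hk (k : Fin (P.d + 1)) : P.circle e₁ e₂ θ k =
      ((P.r * (Real.cos θ * e₁ k + Real.sin θ * e₂ k) : ℝ) : ℂ) := by
    simp [circle]
  refine ⟨⟨WithLp.toLp 2 fun k => P.r * (Real.cos θ * e₁ k + Real.sin θ * e₂ k), ?_⟩, ?_⟩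
  · have hs := sum_circle_sq h₁ h₂ h θ
    simp only [hk] at hs
    norm_cast at hs
    rw [mem_sphere_zero_iff_norm, ← sq_eq_sq₀ (norm_nonneg _) P.r_pos.le,
      EuclideanSpace.real_norm_sq_eq]
    exact hs
  · funext k
    rw [hk]
    rfl

lemma differentiable_circle (e₁ e₂ : P.Ambient) : Differentiable ℂ (P.circle e₁ e₂) := by
  unfold circle
  rw [differentiable_pi]
  intro k
  fun_prop

/-! ### Growth of polynomials in the imaginary directions of the complexified sphere. -/

variable (P) in
/-- A bound for the exponential of the imaginary distance of a point from the real sphere. -/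
def growth (R : ℝ) : ℝ := 2 * (P.d + 1) * R / P.r

lemma norm_toLp_le (v : Fin (P.d + 1) → ℝ) {R : ℝ} (hR : 0 ≤ R) (h : ∀ k, |v k| ≤ R) :
    ‖(WithLp.toLp 2 v : P.Ambient)‖ ≤ (P.d + 1) * R := by
  rw [← sq_le_sq₀ (norm_nonneg _) (by positivity), EuclideanSpace.real_norm_sq_eq]
  calc ∑ k, v k ^ 2 ≤ ∑ _k : Fin (P.d + 1), R ^ 2 :=
        Finset.sum_le_sum fun k _ => sq_le_sq.2 (by rw [abs_of_nonneg hR]; exact h k)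
    _ = (P.d + 1) * R ^ 2 := by simp
    _ ≤ ((P.d + 1) * R) ^ 2 := by
      have : (0 : ℝ) ≤ P.d := P.d.cast_nonneg
      nlinarith [sq_nonneg R, mul_nonneg this (sq_nonneg R)]

/-- Needs d ≥ 1; it supplies the second vector of a great circle through a point with zero imaginary
part. -/
lemma exists_unit_orthogonal {e : P.Ambient} (he : e ≠ 0) : ∃ e' : P.Ambient, ‖e'‖ = 1 ∧ inner ℝ e e' = 0 := by
  have hne : (ℝ ∙ e)ᗮ ≠ ⊥ := by
    intro h
    have h1 := Submodule.finrank_add_finrank_orthogonal (ℝ ∙ e)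
    rw [h, finrank_bot, P.finrank_ambient] at h1
    have h2 := finrank_span_singleton (K := ℝ) he
    have := P.one_le_d
    omega
  obtain ⟨w, hw, hw0⟩ := Submodule.exists_mem_ne_zero_of_ne_bot hne
  refine ⟨‖w‖⁻¹ • w, norm_smul_inv_norm hw0, ?_⟩
  rw [inner_smul_right, Submodule.mem_orthogonal_singleton_iff_inner_right.1 hw, mul_zero]

/-- Write a = u + iv with u, v real. The equation of the sphere says that u ⊥ v and |u|² - |v|² =
r², so u = r cosh t e₁ and v = r sinh t e₂. Then e^t = (|u| + |v|)/r, whence the bound `growth`. -/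
lemma exists_circle_eq (a : P.ComplexSphere) : ∃ (e₁ e₂ : P.Ambient) (t : ℝ),
    ‖e₁‖ = 1 ∧ ‖e₂‖ = 1 ∧ inner ℝ e₁ e₂ = 0 ∧ 0 ≤ t ∧ Real.exp t ≤ P.growth ‖a.1‖ ∧
    P.circle e₁ e₂ (t * Complex.I) = a.1 := by
  have hr := P.r_pos
  set u : P.Ambient := WithLp.toLp 2 fun k => (a.1 k).re with hu
  set v : P.Ambient := WithLp.toLp 2 fun k => (a.1 k).im with hv
  have hun : ‖u‖ ≤ (P.d + 1) * ‖a.1‖ := norm_toLp_le _ (norm_nonneg _) fun k =>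
    (Complex.abs_re_le_norm _).trans (norm_le_pi_norm a.1 k)
  have hvn : ‖v‖ ≤ (P.d + 1) * ‖a.1‖ := norm_toLp_le _ (norm_nonneg _) fun k =>
    (Complex.abs_im_le_norm _).trans (norm_le_pi_norm a.1 k)
  have hre : ‖u‖ ^ 2 - ‖v‖ ^ 2 = P.r ^ 2 := by
    have h := congrArg Complex.re a.2
    rw [Complex.re_sum] at h
    rw [EuclideanSpace.real_norm_sq_eq, EuclideanSpace.real_norm_sq_eq, ← Finset.sum_sub_distrib]
    convert! h using 2
    · simp [hu, hv, sq]
    · simp [sq]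
  have him : inner ℝ u v = 0 := by
    have h := congrArg Complex.im a.2
    rw [Complex.im_sum] at h
    have h2 : ∑ k, (a.1 k ^ 2).im = 2 * inner ℝ u v := by
      rw [PiLp.inner_apply, Finset.mul_sum]
      refine Finset.sum_congr rfl fun k _ => ?_
      simp [hu, hv, sq]
      ring
    rw [h2] at h
    simpa [sq] using h
  have hu0 : 0 < ‖u‖ := by
    by_contra h0
    have : ‖u‖ = 0 := le_antisymm (not_lt.1 h0) (norm_nonneg _)
    rw [this] at hre
    nlinarith [sq_nonneg ‖v‖, pow_pos hr 2]
  obtain ⟨e₂, he₂, he₂u, hve₂⟩ : ∃ e₂ : P.Ambient, ‖e₂‖ = 1 ∧ inner ℝ u e₂ = 0 ∧ ‖v‖ • e₂ = v := by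
    by_cases hv0 : v = 0
    · obtain ⟨e, he, hue⟩ := exists_unit_orthogonal (norm_pos_iff.1 hu0)
      exact ⟨e, he, hue, by rw [hv0]; simp⟩
    · refine ⟨‖v‖⁻¹ • v, norm_smul_inv_norm hv0, by rw [inner_smul_right, him, mul_zero], ?_⟩
      rw [smul_smul, mul_inv_cancel₀ (norm_ne_zero_iff.2 hv0), one_smul]
  have hsinh : Real.sinh (Real.arsinh (‖v‖ / P.r)) = ‖v‖ / P.r := Real.sinh_arsinh _
  have hcosh : Real.cosh (Real.arsinh (‖v‖ / P.r)) = ‖u‖ / P.r := by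
    rw [← sq_eq_sq₀ (Real.cosh_pos _).le (by positivity), Real.cosh_sq, hsinh]
    field_simp
    linarith
  refine ⟨‖u‖⁻¹ • u, e₂, Real.arsinh (‖v‖ / P.r), norm_smul_inv_norm (norm_pos_iff.1 hu0), he₂,
    by rw [real_inner_smul_left, he₂u, mul_zero], Real.arsinh_nonneg_iff.2 (by positivity), ?_, ?_⟩
  · rw [← Real.cosh_add_sinh, hcosh, hsinh, ← add_div, growth]
    gcongr
    linarith
  · funext k
    have hv' : v k = ‖v‖ * e₂ k := by conv_lhs => rw [← hve₂]; simp
    rw [circle, Complex.cos_mul_I, Complex.sin_mul_I, ← Complex.ofReal_cosh, ← Complex.ofReal_sinh,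
      hcosh, hsinh]
    apply Complex.ext
    · simp
      field_simp
      rfl
    · simp
      field_simp
      rw [← hv']

/-- The Laurent polynomial that a polynomial induces on a complexified great circle. -/
lemma exists_entire_circle (e₁ e₂ : P.Ambient) (n : ℕ) : ∀ p ∈ P.polys n,
    ∃ h : ℂ → ℂ, Differentiable ℂ h ∧ ∀ z, h (Complex.exp (z * Complex.I)) =
      Complex.exp (z * Complex.I) ^ n * MvPolynomial.eval (P.circle e₁ e₂ z) p := by
  let S (n : ℕ) : Submodule ℂ (MvPolynomial (Fin (P.d + 1)) ℂ) :=
    { carrier := {p | ∃ h : ℂ → ℂ, Differentiable ℂ h ∧ ∀ z, h (Complex.exp (z * Complex.I)) =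
        Complex.exp (z * Complex.I) ^ n * MvPolynomial.eval (P.circle e₁ e₂ z) p}
      zero_mem' := ⟨0, differentiable_const _, by simp⟩
      add_mem' := by
        rintro p q ⟨h, hd, hh⟩ ⟨h', hd', hh'⟩
        exact ⟨h + h', hd.add hd', fun z => by simp [hh, hh', mul_add]⟩
      smul_mem' := by
        rintro c p ⟨h, hd, hh⟩
        exact ⟨c • h, hd.const_smul c, fun z => by simp [hh]; ring⟩ }
  suffices H : P.polys n ≤ S n from fun p hp => H hp
  induction n with
  | zero =>
    intro p hp
    obtain ⟨c, rfl⟩ := (mem_polySpan_zero _).1 hp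
    exact ⟨fun _ => c, differentiable_const _, by simp⟩
  | succ n ih =>
    refine polySpan_succ_le _ (fun p hp => ?_) fun p hp i => ?_
    · obtain ⟨h, hd, hh⟩ := ih hp
      exact ⟨fun ζ => ζ * h ζ, differentiable_id.mul hd, fun z => by simp only [hh]; ring⟩
    · obtain ⟨h, hd, hh⟩ := ih hp
      -- With ζ = e^{iz}, cos z = (ζ + ζ⁻¹)/2 and sin z = -i(ζ - ζ⁻¹)/2, so ζ times the i-th
      -- coordinate is a quadratic polynomial in ζ.
      refine ⟨fun ζ => (P.r / 2 * ((ζ ^ 2 + 1) * e₁ i - Complex.I * (ζ ^ 2 - 1) * e₂ i)) * h ζ,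
        by fun_prop, fun z => ?_⟩
      have h1 : Complex.exp (-z * Complex.I) * Complex.exp (z * Complex.I) = 1 := by
        rw [← Complex.exp_add]; simp
      simp only [hh, map_mul, MvPolynomial.eval_X, circle, Complex.cos, Complex.sin]
      linear_combination (-(P.r / 2) * e₁ i - Complex.I * (P.r / 2) * e₂ i) *
        (Complex.exp (z * Complex.I) ^ n * MvPolynomial.eval (P.circle e₁ e₂ z) p) * h1

/-- A polynomial bounded on the real sphere grows at most exponentially in the imaginary
directions of the complexified sphere. -/
lemma norm_eval_le {n : ℕ} {p : MvPolynomial (Fin (P.d + 1)) ℂ} (hp : p ∈ P.polys n) {M : ℝ}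
    (hM : ∀ x, ‖(P.res p).1 x‖ ≤ M) (a : P.ComplexSphere) :
    ‖MvPolynomial.eval a.1 p‖ ≤ P.growth ‖a.1‖ ^ n * M := by
  obtain ⟨e₁, e₂, t, h₁, h₂, h₁₂, ht, htg, hta⟩ := exists_circle_eq a
  obtain ⟨h, hd, hh⟩ := exists_entire_circle e₁ e₂ n p hp
  have hM0 : 0 ≤ M := (norm_nonneg _).trans (hM (Classical.arbitrary _))
  have hfr (ζ : ℂ) (hζ : ζ ∈ frontier (Metric.ball (0 : ℂ) 1)) : ‖h ζ‖ ≤ M := by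
    rw [frontier_ball _ one_ne_zero, mem_sphere_zero_iff_norm] at hζ
    obtain ⟨θ, rfl⟩ := (Complex.norm_eq_one_iff ζ).1 hζ
    obtain ⟨x, hx⟩ := exists_ofReal_circle h₁ h₂ h₁₂ θ
    have := hM x
    rw [res_apply, hx] at this
    rw [hh, norm_mul, norm_pow, hζ, one_pow, one_mul]
    exact this
  -- Maximum principle on the unit disc: the boundary corresponds to the real great circle, and a
  -- itself to ζ = e^{-t} with t ≥ 0.
  have hin := Complex.norm_le_of_forall_mem_frontier_norm_le Metric.isBounded_ball
    hd.diffContOnCl hfr (z := Complex.exp (t * Complex.I * Complex.I)) (by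
      rw [closure_ball _ one_ne_zero, mem_closedBall_zero_iff, mul_assoc, Complex.I_mul_I,
        Complex.norm_exp]
      simpa using ht)
  rw [hh, hta, norm_mul, norm_pow, mul_assoc, Complex.I_mul_I, Complex.norm_exp] at hin
  have h3 : (t * (-1 : ℂ)).re = -t := by simp
  rw [h3] at hin
  calc ‖MvPolynomial.eval a.1 p‖
      = Real.exp t ^ n * (Real.exp (-t) ^ n * ‖MvPolynomial.eval a.1 p‖) := by
        rw [← mul_assoc, ← mul_pow, ← Real.exp_add]; simp
    _ ≤ Real.exp t ^ n * M := by gcongr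
    _ ≤ _ := by gcongr

lemma exists_mem_polys (p : MvPolynomial (Fin (P.d + 1)) ℂ) : ∃ n, p ∈ P.polys n := by
  induction p using MvPolynomial.induction_on with
  | C c => exact ⟨0, (mem_polySpan_zero _).2 ⟨c, rfl⟩⟩
  | add p q hp hq =>
    obtain ⟨m, hm⟩ := hp
    obtain ⟨n, hn⟩ := hq
    exact ⟨max m n, add_mem (polySpan_mono _ (le_max_left _ _) hm)
      (polySpan_mono _ (le_max_right _ _) hn)⟩
  | mul_X p i hp =>
    obtain ⟨m, hm⟩ := hp
    exact ⟨m + 1, mul_comm p _ ▸ mul_mem_polySpan _ i hm⟩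

/-- The growth bound with M = 0: a polynomial vanishing on the real sphere vanishes on the
complexified one. -/
lemma eval_eq_of_res_eq {p q : MvPolynomial (Fin (P.d + 1)) ℂ} (h : P.res p = P.res q)
    (a : P.ComplexSphere) : MvPolynomial.eval a.1 p = MvPolynomial.eval a.1 q := by
  obtain ⟨n, hn⟩ := exists_mem_polys (p - q)
  have h2 := norm_eval_le hn (M := 0) (fun x => by rw [map_sub, h, sub_self]; simp) a
  rw [mul_zero, map_sub] at h2
  exact sub_eq_zero.1 (norm_le_zero_iff.1 h2)

end

end SphereParticle

namespace SphereParticle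

noncomputable section

variable {P : SphereParticle}

/-! ### Pointwise bounds for polynomial functions -/

variable (P) in
/-- The action of isometries on smooth functions. -/
def compS (R : P.Ambient ≃ₗᵢ[ℝ] P.Ambient) : P.smoothAlg →ₐ[ℂ] P.smoothAlg :=
  AlgHom.codRestrict ((ContinuousMap.compRightAlgHom ℂ ℂ (P.sphereMap R)).comp P.smoothAlg.val)
    P.smoothAlg fun f => by
      have hf : ContDiffOn ℝ ∞ (P.radialExt f.1) {0}ᶜ := f.2
      refine P.contDiffOn_radialExt (F := P.radialExt f.1 ∘ R)
        (hf.comp R.contDiff.contDiffOn fun y hy => ?_) fun x => ?_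
      · simpa using hy
      · exact (P.radialExt_coe f.1 (P.sphereMap R x)).symm

lemma compS_apply (R : P.Ambient ≃ₗᵢ[ℝ] P.Ambient) (f : P.smoothAlg) (x : P.Sphere) :
    (P.compS R f).1 x = f.1 (P.sphereMap R x) := rfl

lemma compS_coordS_mem (R : P.Ambient ≃ₗᵢ[ℝ] P.Ambient) (i : Fin (P.d + 1)) :
    P.compS R (P.coordS i) ∈ Submodule.span ℂ (insert 1 (Set.range P.coordS)) := by
  have h : P.compS R (P.coordS i) =
      ∑ j, ((R (EuclideanSpace.single j 1) i : ℝ) : ℂ) • P.coordS j := by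
    refine P.smoothAlg_ext fun x => ?_
    have hx : (x : P.Ambient) = ∑ j, (x : P.Ambient) j • EuclideanSpace.single j (1 : ℝ) := by
      ext k; simp [Finset.sum_apply, Pi.single_apply]
    have h1 : R (x : P.Ambient) i =
        ∑ j, (x : P.Ambient) j * R (EuclideanSpace.single j (1 : ℝ)) i := by
      conv_lhs => rw [hx, map_sum]
      simp
    change ((R (x : P.Ambient) i : ℝ) : ℂ) = _
    rw [h1]
    simp [coordS, coord, mul_comm]
  rw [h]
  exact Submodule.sum_mem _ fun j _ => Submodule.smul_mem _ _
    (Submodule.subset_span (Set.mem_insert_of_mem _ ⟨j, rfl⟩))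

lemma compS_mem (R : P.Ambient ≃ₗᵢ[ℝ] P.Ambient) {n : ℕ} {f : P.smoothAlg}
    (hf : f ∈ P.polyFns n) : P.compS R f ∈ P.polyFns n := by
  have h := Submodule.mem_map_of_mem (f := (P.compS R).toLinearMap) hf
  rw [polyFns, map_polySpan] at h
  refine pow_le_pow_left' (Submodule.span_le.2 ?_) n h
  rintro _ (rfl | ⟨i, rfl⟩)
  · exact Submodule.subset_span (Set.mem_insert _ _)
  · exact compS_coordS_mem R i

lemma norm_toL2S_compS (R : P.Ambient ≃ₗᵢ[ℝ] P.Ambient) (f : P.smoothAlg) :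
    ‖P.toL2S (P.compS R f)‖ = ‖P.toL2S f‖ := by
  have h : inner ℂ (P.toL2S (P.compS R f)) (P.toL2S (P.compS R f)) =
      inner ℂ (P.toL2S f) (P.toL2S f) := by
    rw [toL2S_apply, toL2S_apply, inner_toL2, inner_toL2]
    exact P.integral_comp_sphereMap R (f.1 * star f.1)
  rw [inner_self_eq_norm_sq_to_K, inner_self_eq_norm_sq_to_K] at h
  have h2 : ‖P.toL2S (P.compS R f)‖ ^ 2 = ‖P.toL2S f‖ ^ 2 := by exact_mod_cast h
  exact (sq_eq_sq₀ (norm_nonneg _) (norm_nonneg _)).1 h2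

/-- Counts n-fold products of the d+2 generators 1, x_1, …, x_{d+1}. This crude exponential bound is
all that the convergence needs. -/
lemma finrank_polyL2_le (n : ℕ) : Module.finrank ℂ (P.polyL2 n) ≤ (P.d + 2) ^ n := by
  classical
  refine (Submodule.finrank_map_le _ _).trans ?_
  have hs : (insert 1 (Set.range P.coordS) : Set P.smoothAlg) =
      ((insert 1 (Finset.univ.image P.coordS) : Finset P.smoothAlg) : Set P.smoothAlg) := by simp
  rw [polyFns, polySpan, hs, Submodule.span_pow, ← Finset.coe_pow]
  refine (finrank_span_finset_le_card _).trans (Finset.card_pow_le.trans ?_)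
  gcongr
  refine (Finset.card_insert_le _ _).trans ?_
  have := Finset.card_image_le (s := Finset.univ) (f := P.coordS)
  simp at this ⊢
  omega

variable (P) in
/-- The square of the norm of point evaluations on the polynomials of degree at most `n`. -/
def evalBound (n : ℕ) : ℝ := (P.d + 2) ^ n / P.surfaceMeasure.real Set.univ

lemma evalBound_nonneg (n : ℕ) : 0 ≤ P.evalBound n := by
  unfold evalBound; positivity

/-- K(x) = ∑ |β_j(x)|² over an orthonormal basis is the best constant in the inequality at x, by
Cauchy–Schwarz. Transitivity of the isometries makes it constant, and its integral is the dimension,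
so K is the dimension divided by the total area. -/
lemma norm_apply_sq_le {n : ℕ} {f : P.smoothAlg} (hf : f ∈ P.polyFns n) (x : P.Sphere) :
    ‖f.1 x‖ ^ 2 ≤ P.evalBound n * ‖P.toL2S f‖ ^ 2 := by
  let b := stdOrthonormalBasis ℂ (P.polyL2 n)
  have hb (j) : ∃ g ∈ P.polyFns n, P.toL2S g = b j := (b j).2
  choose β hβ hβb using hb
  have hon (i j) : inner ℂ (b i : P.Hilb) (b j) = if i = j then 1 else 0 :=
    orthonormal_iff_ite.1 b.orthonormal i j
  set K : P.Sphere → ℝ := fun x => ∑ j, ‖(β j).1 x‖ ^ 2 with hK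
  have hexp {g : P.smoothAlg} (hg : g ∈ P.polyFns n) (x : P.Sphere) :
      ‖g.1 x‖ ^ 2 ≤ K x * ‖P.toL2S g‖ ^ 2 := by
    let w : P.polyL2 n := ⟨P.toL2S g, g, hg, rfl⟩
    have h1 : g = ∑ j, inner ℂ (b j) w • β j := by
      apply P.toL2S_injective
      have := congrArg (Submodule.subtype _) (b.sum_repr' w)
      rw [map_sum] at this
      simp only [map_sum, map_smul, hβb]
      simpa using this.symm
    have h2 : g.1 x = ∑ j, inner ℂ (b j) w * (β j).1 x := by
      conv_lhs => rw [h1]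
      simp
    have h3 : ‖P.toL2S g‖ ^ 2 = ∑ j, ‖inner ℂ (b j) w‖ ^ 2 := (b.sum_sq_norm_inner_right w).symm
    rw [h2, h3, mul_comm]
    calc _ ≤ (∑ j, ‖inner ℂ (b j) w‖ * ‖(β j).1 x‖) ^ 2 := by
          gcongr
          exact (norm_sum_le _ _).trans_eq (by simp only [norm_mul])
      _ ≤ _ := Finset.sum_mul_sq_le_sq_mul_sq _ _ _
  have hle (x y : P.Sphere) : K y ≤ K x := by
    obtain ⟨R, hR⟩ := P.exists_sphereMap_eq x y
    -- The extremal function at y: g(y) = ‖g‖² = K(y). Moved to x by an isometry, it shows K(y)² ≤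
    -- K(x) K(y).
    let g : P.smoothAlg := ∑ j, conj ((β j).1 y) • β j
    have hg : g ∈ P.polyFns n := Submodule.sum_mem _ fun j _ => Submodule.smul_mem _ _ (hβ j)
    have hgy : g.1 y = (K y : ℂ) := by
      simp only [g, hK]
      simp [Complex.conj_mul']
    have hgn : ‖P.toL2S g‖ ^ 2 = K y := by
      have : inner ℂ (P.toL2S g) (P.toL2S g) = (K y : ℂ) := by
        simp only [g, map_sum, map_smul, hβb, sum_inner, inner_sum, inner_smul_left,
          inner_smul_right, hon]
        simp [hK, Complex.conj_mul']
      rw [inner_self_eq_norm_sq_to_K] at this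
      exact Complex.ofReal_injective (by simpa using this)
    have h := hexp (compS_mem R hg) x
    rw [compS_apply, hR, hgy, norm_toL2S_compS, hgn, Complex.norm_real, Real.norm_eq_abs, sq_abs] at h
    have hKy : 0 ≤ K y := Finset.sum_nonneg fun j _ => sq_nonneg _
    rcases hKy.eq_or_lt with h0 | h0
    · rw [← h0]; exact Finset.sum_nonneg fun j _ => sq_nonneg _
    · nlinarith
  have hint : ∫ y, K y ∂P.surfaceMeasure = Module.finrank ℂ (P.polyL2 n) := by
    have h1 (j) : ∫ y, ‖(β j).1 y‖ ^ 2 ∂P.surfaceMeasure = 1 := by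
      have h2 := hon j j
      rw [← hβb, toL2S_apply, inner_toL2, if_pos rfl] at h2
      simp only [Complex.mul_conj'] at h2
      have h3 : ∫ y, ((‖(β j).1 y‖ ^ 2 : ℝ) : ℂ) ∂P.surfaceMeasure = 1 := by
        rw [← h2]; simp
      rw [integral_complex_ofReal] at h3
      exact_mod_cast h3
    rw [integral_finsetSum]
    · simp [h1]
    · intro j _
      have hc : Continuous fun y => ‖(β j).1 y‖ ^ 2 := by fun_prop
      exact hc.integrable_of_hasCompactSupport (HasCompactSupport.of_compactSpace _)
  have hconst : K x * P.surfaceMeasure.real Set.univ = Module.finrank ℂ (P.polyL2 n) := by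
    rw [← hint, ← integral_congr_ae (.of_forall fun y => le_antisymm (hle y x) (hle x y)),
      integral_const, smul_eq_mul, mul_comm]
  refine (hexp hf x).trans ?_
  gcongr
  rw [evalBound, le_div_iff₀ P.surfaceMeasure_real_univ_pos, hconst]
  exact_mod_cast finrank_polyL2_le n

lemma norm_apply_le {n : ℕ} {f : P.smoothAlg} (hf : f ∈ P.polyFns n) (x : P.Sphere) :
    ‖f.1 x‖ ≤ √(P.evalBound n) * ‖P.toL2S f‖ := by
  rw [← Real.sqrt_sq (norm_nonneg (P.toL2S f)), ← Real.sqrt_mul (evalBound_nonneg n)]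
  exact Real.le_sqrt_of_sq_le (norm_apply_sq_le hf x)

end

end SphereParticle

namespace SphereParticle

noncomputable section

variable {P : SphereParticle}

/-! ### Zonal harmonics -/

variable (P) in
lemma exists_polynomial_basis (n : ℕ) :
    ∃ q : Fin (Module.finrank ℂ (P.harm n)) → MvPolynomial (Fin (P.d + 1)) ℂ,
      ∀ j, q j ∈ P.polys n ∧ P.toL2S (P.res (q j)) = stdOrthonormalBasis ℂ (P.harm n) j := by
  have h (j) : ∃ p ∈ P.polys n, P.toL2S (P.res p) = stdOrthonormalBasis ℂ (P.harm n) j := by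
    obtain ⟨f, hf, hfb, -⟩ := P.exists_of_mem_harm (stdOrthonormalBasis ℂ (P.harm n) j).2
    obtain ⟨p, hp, rfl⟩ := P.exists_res_eq hf
    exact ⟨p, hp, hfb⟩
  choose q hq using h
  exact ⟨q, hq⟩

variable (P) in
/-- Polynomials that restrict to an orthonormal basis of the spherical harmonics of degree `n`. -/
def harmPoly (n : ℕ) : Fin (Module.finrank ℂ (P.harm n)) → MvPolynomial (Fin (P.d + 1)) ℂ :=
  (P.exists_polynomial_basis n).choose

lemma harmPoly_mem (n : ℕ) (j) : P.harmPoly n j ∈ P.polys n :=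
  ((P.exists_polynomial_basis n).choose_spec j).1

lemma toL2S_res_harmPoly (n : ℕ) (j) : P.toL2S (P.res (P.harmPoly n j)) =
    stdOrthonormalBasis ℂ (P.harm n) j :=
  ((P.exists_polynomial_basis n).choose_spec j).2

variable (P) in
/-- The zonal polynomial of degree `n` with pole `a`. -/
def zonalPoly (n : ℕ) (a : Fin (P.d + 1) → ℂ) : MvPolynomial (Fin (P.d + 1)) ℂ :=
  -- Conjugating the coefficients rather than the value keeps the dependence on the pole a
  -- holomorphic; at real a the result is the conjugate of the value.
  ∑ j, MvPolynomial.eval a (MvPolynomial.map (starRingEnd ℂ) (P.harmPoly n j)) • P.harmPoly n j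

variable (P) in
/-- The zonal spherical harmonic of degree `n` with pole `a`. -/
def zonal (n : ℕ) (a : Fin (P.d + 1) → ℂ) : P.Hilb :=
  ∑ j, MvPolynomial.eval a (MvPolynomial.map (starRingEnd ℂ) (P.harmPoly n j)) •
    (stdOrthonormalBasis ℂ (P.harm n) j : P.Hilb)

lemma zonalPoly_mem (n : ℕ) (a : Fin (P.d + 1) → ℂ) : P.zonalPoly n a ∈ P.polys n :=
  Submodule.sum_mem _ fun j _ => Submodule.smul_mem _ _ (harmPoly_mem n j)

lemma toL2S_res_zonalPoly (n : ℕ) (a : Fin (P.d + 1) → ℂ) :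
    P.toL2S (P.res (P.zonalPoly n a)) = P.zonal n a := by
  simp only [zonalPoly, zonal, map_sum, map_smul, toL2S_res_harmPoly]

lemma zonal_mem (n : ℕ) (a : Fin (P.d + 1) → ℂ) : P.zonal n a ∈ P.harm n :=
  Submodule.sum_mem _ fun _ _ => Submodule.smul_mem _ _ (Subtype.mem _)

lemma differentiable_eval {σ : Type*} [Fintype σ] (p : MvPolynomial σ ℂ) :
    Differentiable ℂ fun a : σ → ℂ => MvPolynomial.eval a p := by
  induction p using MvPolynomial.induction_on with
  | C c => simp
  | add p q hp hq => simp only [map_add]; exact hp.add hq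
  | mul_X p i hp => simp only [map_mul, MvPolynomial.eval_X]; exact hp.mul (differentiable_apply i)

lemma differentiable_zonal (n : ℕ) : Differentiable ℂ (P.zonal n) := by
  unfold zonal
  exact Differentiable.fun_sum fun j _ => (differentiable_eval _).smul_const _

lemma differentiable_eval_zonalPoly (n : ℕ) : Differentiable ℂ
    fun p : (Fin (P.d + 1) → ℂ) × (Fin (P.d + 1) → ℂ) =>
      MvPolynomial.eval p.2 (P.zonalPoly n p.1) := by
  simp only [zonalPoly, map_sum (MvPolynomial.eval _), MvPolynomial.smul_eval]
  refine Differentiable.fun_sum fun j _ => ?_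
  exact (Differentiable.comp (g := fun a => MvPolynomial.eval a _) (differentiable_eval _)
    differentiable_fst).mul (Differentiable.comp (g := fun a => MvPolynomial.eval a _)
    (differentiable_eval _) differentiable_snd)

/-- Complex conjugation on the complexified sphere. -/
def conjPt (a : P.ComplexSphere) : P.ComplexSphere :=
  ⟨fun k => conj (a.1 k), by
    have h := congrArg conj a.2
    simpa using h⟩

lemma norm_conjPt (a : P.ComplexSphere) : ‖(conjPt a).1‖ = ‖a.1‖ := by
  simp [conjPt, Pi.norm_def]

lemma conjPt_ofReal (x : P.Sphere) : conjPt (P.ofReal x) = P.ofReal x := by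
  ext k; simp [conjPt, ofReal]

lemma eval_map_conj (a : P.ComplexSphere) (p : MvPolynomial (Fin (P.d + 1)) ℂ) :
    MvPolynomial.eval a.1 (MvPolynomial.map (starRingEnd ℂ) p) =
      conj (MvPolynomial.eval (conjPt a).1 p) := by
  induction p using MvPolynomial.induction_on with
  | C c => simp
  | add p q hp hq => simp [hp, hq]
  | mul_X p i hp => simp [hp, conjPt]

/-- The reproducing property of the zonal harmonics. -/
lemma inner_zonal {n : ℕ} {p : MvPolynomial (Fin (P.d + 1)) ℂ}
    (hp : P.toL2S (P.res p) ∈ P.harm n) (a : P.ComplexSphere) :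
    inner ℂ (P.zonal n a.1) (P.toL2S (P.res p)) = MvPolynomial.eval (conjPt a).1 p := by
  set b := stdOrthonormalBasis ℂ (P.harm n) with hb
  have h1 : P.res p = P.res (∑ j, inner ℂ (b j : P.Hilb) (P.toL2S (P.res p)) • P.harmPoly n j) := by
    apply P.toL2S_injective
    have := congrArg (Submodule.subtype _) (b.sum_repr' ⟨_, hp⟩)
    rw [map_sum] at this
    simp only [map_sum, map_smul, toL2S_res_harmPoly, ← hb]
    simpa using this.symm
  -- The basis expansion holds on the real sphere, and therefore also at the complex point `conjPt
  -- a`.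
  rw [eval_eq_of_res_eq h1, zonal, sum_inner, map_sum]
  refine Finset.sum_congr rfl fun j _ => ?_
  rw [inner_smul_left, eval_map_conj, MvPolynomial.smul_eval, Complex.conj_conj, mul_comm]

lemma norm_eval_harm_le {n : ℕ} {p : MvPolynomial (Fin (P.d + 1)) ℂ} (hp : p ∈ P.polys n)
    (a : P.ComplexSphere) : ‖MvPolynomial.eval a.1 p‖ ≤
      P.growth ‖a.1‖ ^ n * (√(P.evalBound n) * ‖P.toL2S (P.res p)‖) :=
  norm_eval_le hp (fun x => norm_apply_le (P.res_mem hp) x) a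

lemma growth_nonneg {R : ℝ} (hR : 0 ≤ R) : 0 ≤ P.growth R := by
  have := P.r_pos
  unfold growth; positivity

/-- By the reproducing property ‖Z_a‖² is the value of Z_a at the conjugate point, which is at most
a constant times ‖Z_a‖; divide by ‖Z_a‖. -/
lemma norm_zonal_le (n : ℕ) (a : P.ComplexSphere) :
    ‖P.zonal n a.1‖ ≤ P.growth ‖a.1‖ ^ n * √(P.evalBound n) := by
  have h1 : ‖P.zonal n a.1‖ ^ 2 = ‖MvPolynomial.eval (conjPt a).1 (P.zonalPoly n a.1)‖ := by
    rw [← inner_zonal (by rw [toL2S_res_zonalPoly]; exact zonal_mem n _), toL2S_res_zonalPoly,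
      inner_self_eq_norm_sq_to_K]
    simp
  have h2 := norm_eval_harm_le (zonalPoly_mem n a.1) (conjPt a)
  rw [← h1, norm_conjPt, toL2S_res_zonalPoly] at h2
  rcases (norm_nonneg (P.zonal n a.1)).eq_or_lt with h0 | h0
  · rw [← h0]
    have := growth_nonneg (P := P) (norm_nonneg a.1)
    positivity
  · nlinarith

lemma norm_eval_zonalPoly_le (n : ℕ) (a b : P.ComplexSphere) :
    ‖MvPolynomial.eval b.1 (P.zonalPoly n a.1)‖ ≤
      (P.growth ‖a.1‖ * P.growth ‖b.1‖) ^ n * P.evalBound n := by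
  have h := norm_eval_harm_le (zonalPoly_mem n a.1) b
  rw [toL2S_res_zonalPoly] at h
  have hb := growth_nonneg (P := P) (norm_nonneg b.1)
  calc _ ≤ _ := h
    _ ≤ P.growth ‖b.1‖ ^ n * (√(P.evalBound n) * (P.growth ‖a.1‖ ^ n * √(P.evalBound n))) := by
      gcongr; exact norm_zonal_le n a
    _ = (P.growth ‖a.1‖ * P.growth ‖b.1‖) ^ n * (√(P.evalBound n) * √(P.evalBound n)) := by ring
    _ = _ := by rw [Real.mul_self_sqrt (evalBound_nonneg n)]

lemma summable_decay_mul_evalBound {K : ℝ} (hK : 0 ≤ K) :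
    Summable fun n => P.decay n * (K ^ n * P.evalBound n) := by
  have h := (P.summable_decay_mul_pow (K := K * (P.d + 2)) (by positivity)).mul_right
    (P.surfaceMeasure.real Set.univ)⁻¹
  refine h.congr fun n => ?_
  rw [evalBound, mul_pow]
  ring

lemma summable_decay_mul_sqrt {K : ℝ} (hK : 0 ≤ K) :
    Summable fun n => P.decay n * (K ^ n * √(P.evalBound n)) := by
  refine Summable.of_nonneg_of_le (fun n => ?_) (fun n => ?_)
    ((P.summable_decay_mul_pow hK).add (P.summable_decay_mul_evalBound hK))
  · have := P.decay_pos n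
    positivity
  · rw [← mul_add]
    have := P.decay_pos n
    have h1 : √(P.evalBound n) ≤ 1 + P.evalBound n := by
      rw [Real.sqrt_le_iff]
      have := evalBound_nonneg (P := P) n
      constructor <;> nlinarith
    have hk : 0 ≤ K ^ n := pow_nonneg hK n
    have : K ^ n * √(P.evalBound n) ≤ K ^ n + K ^ n * P.evalBound n := by nlinarith
    gcongr

lemma zonal_ne_zero (a : P.ComplexSphere) : P.zonal 0 a.1 ≠ 0 := by
  intro h
  have h1 : P.toL2S (P.res 1) ∈ P.harm 0 := ⟨1, by simpa using P.algebraMap_mem_polyFns 1, by simp⟩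
  have h2 := inner_zonal h1 a
  rw [h, inner_zero_left] at h2
  simp at h2

lemma inner_zonal_ofReal {n : ℕ} {f : P.smoothAlg} (hf : f ∈ P.polyFns n)
    (hfn : P.toL2S f ∈ P.harm n) (x : P.Sphere) :
    inner ℂ (P.zonal n (P.ofReal x).1) (P.toL2S f) = f.1 x := by
  obtain ⟨p, -, rfl⟩ := P.exists_res_eq hf
  rw [inner_zonal hfn, conjPt_ofReal, res_apply]

lemma inner_toL2S_starS (f g : P.smoothAlg) :
    inner ℂ (P.toL2S (P.starS f)) (P.toL2S g) =
      conj (inner ℂ (P.toL2S f) (P.toL2S (P.starS g))) := by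
  rw [toL2S_apply, toL2S_apply, toL2S_apply, toL2S_apply, inner_toL2, inner_toL2, ← integral_conj]
  refine integral_congr_ae (.of_forall fun x => ?_)
  simp [starS]

lemma toL2S_starS_mem {n : ℕ} {f : P.smoothAlg} (hf : P.toL2S f ∈ P.harm n) :
    P.toL2S (P.starS f) ∈ P.harm n := by
  have hpoly {m : ℕ} (h : P.toL2S f ∈ P.polyL2 m) : P.toL2S (P.starS f) ∈ P.polyL2 m := by
    obtain ⟨g, hg, hgf⟩ := h
    rw [← P.toL2S_injective hgf]
    exact ⟨_, P.starS_mem hg, rfl⟩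
  cases n with
  | zero => exact hpoly hf
  | succ n =>
    refine ⟨?_, hpoly hf.2⟩
    rintro _ ⟨g, hg, rfl⟩
    rw [← inner_conj_symm, inner_toL2S_starS, Complex.conj_conj, ← inner_conj_symm,
      hf.1 _ ⟨_, P.starS_mem hg, rfl⟩, map_zero]

/-- The harmonics of degree n are stable under conjugation, so for a real pole the conjugate of the
zonal harmonic reproduces values too, and the reproducing element is unique. -/
lemma conj_eval_zonalPoly (n : ℕ) (x y : P.Sphere) :
    conj (MvPolynomial.eval (P.ofReal y).1 (P.zonalPoly n (P.ofReal x).1)) =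
      MvPolynomial.eval (P.ofReal y).1 (P.zonalPoly n (P.ofReal x).1) := by
  rw [← res_apply]
  set z := P.res (P.zonalPoly n (P.ofReal x).1) with hz
  have hzp : z ∈ P.polyFns n := P.res_mem (zonalPoly_mem n _)
  have hzL : P.toL2S z = P.zonal n (P.ofReal x).1 := toL2S_res_zonalPoly n _
  have hzh : P.toL2S z ∈ P.harm n := hzL ▸ zonal_mem n _
  have h1 (g : P.smoothAlg) (hg : g ∈ P.polyFns n) (hgh : P.toL2S g ∈ P.harm n) :
      inner ℂ (P.toL2S (P.starS z) - P.toL2S z) (P.toL2S g) = 0 := by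
    rw [inner_sub_left, inner_toL2S_starS, hzL,
      inner_zonal_ofReal (P.starS_mem hg) (toL2S_starS_mem hgh), inner_zonal_ofReal hg hgh]
    simp [starS]
  have h2 := h1 (P.starS z - z) (sub_mem (P.starS_mem hzp) hzp)
    (by rw [map_sub]; exact sub_mem (toL2S_starS_mem hzh) hzh)
  rw [map_sub, inner_self_eq_zero, ← map_sub] at h2
  have h3 : P.starS z - z = 0 := P.toL2S_injective (by rw [h2, map_zero])
  exact congrArg (fun f => f.1 y) (sub_eq_zero.1 h3)

end

end SphereParticle

namespace SphereParticle

noncomputable section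

/-! ### Series of holomorphic functions -/

section Holomorphic

variable {X E V : Type*} [NormedAddCommGroup E] [NormedSpace ℂ E]
  [NormedAddCommGroup V] [NormedSpace ℂ V] [CompleteSpace V]

/-- The Weierstrass theorem for series of holomorphic functions on a normed space. -/
lemma differentiableOn_tsum_of_bounded {F : ℕ → E → V} {U : Set E} (hU : IsOpen U)
    (hd : ∀ n, DifferentiableOn ℂ (F n) U) {M : ℕ → ℝ} (hM : Summable M)
    (hF : ∀ n, ∀ z ∈ U, ‖F n z‖ ≤ M n) : DifferentiableOn ℂ (fun z => ∑' n, F n z) U := by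
  intro z₀ hz₀
  obtain ⟨ε, hε, hball⟩ := Metric.isOpen_iff.1 hU z₀ hz₀
  set δ := ε / 2 with hδ
  have hδ0 : 0 < δ := half_pos hε
  have hsub {y : E} (hy : y ∈ Metric.ball z₀ δ) : Metric.ball y δ ⊆ U := by
    refine Set.Subset.trans (Metric.ball_subset_ball' ?_) hball
    have := Metric.mem_ball.1 hy
    linarith
  have hyU {y : E} (hy : y ∈ Metric.ball z₀ δ) : y ∈ U := hsub hy (Metric.mem_ball_self hδ0)
  have hz : z₀ ∈ Metric.ball z₀ δ := Metric.mem_ball_self hδ0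
  -- Termwise differentiation; Cauchy's estimate on balls of radius δ, where `F n` varies by at most
  -- 2 M n, gives the bound 2 M n / δ.
  refine (hasFDerivAt_tsum_of_isPreconnected (u := fun n => 2 * M n / δ)
    (f' := fun n y => fderiv ℂ (F n) y) ((hM.mul_left 2).div_const δ) Metric.isOpen_ball
    (Metric.isConnected_ball hδ0).isPreconnected
    (fun n y hy => ((hd n).differentiableAt (hU.mem_nhds (hyU hy))).hasFDerivAt)
    (fun n y hy => ?_) hz (Summable.of_norm_bounded hM fun n => hF n z₀ hz₀)
    hz).differentiableAt.differentiableWithinAt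
  refine Complex.norm_fderiv_le_div_of_mapsTo_ball ((hd n).mono (hsub hy)) (fun w hw => ?_) hδ0
  rw [Metric.mem_closedBall, dist_eq_norm]
  have := hF n w (hsub hy hw)
  have := hF n y (hyU hy)
  exact (norm_sub_le _ _).trans (by linarith)

/-- The image of `ι` is locally a holomorphic retract. -/
def IsHolomorphicRetract (ι : X → E) : Prop :=
  ∀ x : X, ∃ (U : Set E) (π : E → X), IsOpen U ∧ ι x ∈ U ∧ DifferentiableOn ℂ (ι ∘ π) U ∧
    ∀ y, ι y ∈ U → π (ι y) = y

/-- The bounds hold only on the image of `ι`, so the ambient series need not converge nearby.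
Composing each term with the retraction evaluates it at points of `X` only. -/
lemma isHolomorphicAlong_tsum {ι : X → E} (hι : IsHolomorphicRetract ι) {G : ℕ → E → V}
    (hG : ∀ n, Differentiable ℂ (G n))
    (hM : ∀ R, ∃ M : ℕ → ℝ, Summable M ∧ ∀ n x, ‖ι x‖ ≤ R → ‖G n (ι x)‖ ≤ M n) :
    IsHolomorphicAlong ι fun x => ∑' n, G n (ι x) := by
  intro x
  obtain ⟨U, π, hU, hxU, hπ, hπι⟩ := hι x
  obtain ⟨M, hMs, hM⟩ := hM (‖ι x‖ + 1)
  refine ⟨U ∩ (ι ∘ π) ⁻¹' Metric.ball 0 (‖ι x‖ + 1), fun e => ∑' n, G n (ι (π e)),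
    hπ.continuousOn.isOpen_inter_preimage hU Metric.isOpen_ball, ⟨hxU, ?_⟩, ?_, fun y hy => ?_⟩
  · simp [hπι x hxU]
  · refine differentiableOn_tsum_of_bounded
      (hπ.continuousOn.isOpen_inter_preimage hU Metric.isOpen_ball)
      (fun n => (hG n).comp_differentiableOn (hπ.mono Set.inter_subset_left)) hMs
      fun n z hz => hM n _ ?_
    exact (mem_ball_zero_iff.1 hz.2).le
  · simp only [hπι y hy.1]

lemma IsHolomorphicRetract.prodMap {Y E' : Type*} [NormedAddCommGroup E'] [NormedSpace ℂ E']
    {ι : X → E} {ι' : Y → E'} (h : IsHolomorphicRetract ι) (h' : IsHolomorphicRetract ι') :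
    IsHolomorphicRetract (Prod.map ι ι') := by
  rintro ⟨x, y⟩
  obtain ⟨U, π, hU, hxU, hπ, hπι⟩ := h x
  obtain ⟨U', π', hU', hxU', hπ', hπι'⟩ := h' y
  refine ⟨U ×ˢ U', Prod.map π π', hU.prod hU', ⟨hxU, hxU'⟩, ?_, ?_⟩
  · exact (hπ.comp differentiableOn_fst fun p hp => hp.1).prodMk
      (hπ'.comp differentiableOn_snd fun p hp => hp.2)
  · rintro ⟨a, b⟩ ⟨ha, hb⟩
    exact Prod.ext (hπι a ha) (hπι' b hb)

omit [CompleteSpace V] in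
lemma _root_.IsHolomorphicAlong.differentiable_comp {ι : X → E} {F : X → V}
    (hF : IsHolomorphicAlong ι F) {γ : ℂ → X} (hγ : Differentiable ℂ (ι ∘ γ)) :
    Differentiable ℂ (F ∘ γ) := by
  intro z
  obtain ⟨U, G, hU, hzU, hG, hGF⟩ := hF (γ z)
  have h : DifferentiableAt ℂ (G ∘ (ι ∘ γ)) z :=
    (hG.differentiableAt (hU.mem_nhds hzU)).comp z (hγ z)
  refine h.congr_of_eventuallyEq ?_
  filter_upwards [hγ.continuous.continuousAt.preimage_mem_nhds (hU.mem_nhds hzU)] with w hw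
  exact (hGF (γ w) hw).symm

omit [CompleteSpace V] in
lemma _root_.IsHolomorphicAlong.continuous_comp {Y : Type*} [TopologicalSpace Y] {ι : X → E} {F : X → V}
    (hF : IsHolomorphicAlong ι F) {c : Y → X} (hc : Continuous (ι ∘ c)) : Continuous (F ∘ c) := by
  rw [continuous_iff_continuousAt]
  intro y
  obtain ⟨U, G, hU, hzU, hG, hGF⟩ := hF (c y)
  have h : ContinuousAt (G ∘ (ι ∘ c)) y :=
    ContinuousAt.comp (f := ι ∘ c) (hG.differentiableAt (hU.mem_nhds hzU)).continuousAt
      hc.continuousAt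
  refine h.congr ?_
  filter_upwards [hc.continuousAt.preimage_mem_nhds (hU.mem_nhds hzU)] with w hw
  exact hGF (c w) hw

/-- Identity theorem: both compositions with γ are entire and agree on the reals, which accumulate
at 0. -/
lemma _root_.IsHolomorphicAlong.eq_of_curve {ι : X → E} {F F' : X → V} (hF : IsHolomorphicAlong ι F)
    (hF' : IsHolomorphicAlong ι F') {γ : ℂ → X} (hγ : Differentiable ℂ (ι ∘ γ))
    (h : ∀ θ : ℝ, F (γ θ) = F' (γ θ)) (z : ℂ) : F (γ z) = F' (γ z) := by
  have h1 := (hF.differentiable_comp hγ).differentiableOn.analyticOnNhd isOpen_univ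
  have h2 := (hF'.differentiable_comp hγ).differentiableOn.analyticOnNhd isOpen_univ
  refine congrFun (h1.eq_of_frequently_eq h2 (z₀ := 0) ?_) z
  have ht : Filter.Tendsto (fun n : ℕ => (((n : ℝ) + 1)⁻¹ : ℝ)) Filter.atTop (nhdsWithin 0 {0}ᶜ) := by
    refine tendsto_nhdsWithin_iff.2 ⟨?_, .of_forall fun n => ?_⟩
    · simpa using tendsto_one_div_add_atTop_nhds_zero_nat (𝕜 := ℝ)
    · have : ((n : ℝ) + 1)⁻¹ ≠ 0 := by positivity
      simpa using this
  have ht' : Filter.Tendsto (fun x : ℝ => (x : ℂ)) (nhdsWithin 0 {0}ᶜ) (nhdsWithin 0 {0}ᶜ) := by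
    refine tendsto_nhdsWithin_of_tendsto_nhds_of_eventually_within _ ?_ ?_
    · exact (Complex.continuous_ofReal.tendsto' 0 0 (by simp)).mono_left nhdsWithin_le_nhds
    · filter_upwards [self_mem_nhdsWithin] with x hx
      simpa using hx
  exact (ht'.comp ht).frequently (Filter.Frequently.of_forall fun n => h _)

end Holomorphic

variable {P : SphereParticle}

lemma isHolomorphicRetract_complexSphere :
    IsHolomorphicRetract (Subtype.val : P.ComplexSphere → Fin (P.d + 1) → ℂ) := by
  classical
  intro x
  have hr : (P.r : ℂ) ≠ 0 := by exact_mod_cast P.r_pos.ne'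
  let q : (Fin (P.d + 1) → ℂ) → ℂ := fun z => (∑ k, z k ^ 2) / (P.r : ℂ) ^ 2
  have hq : Differentiable ℂ q := by
    simp only [q, div_eq_mul_inv]
    refine Differentiable.mul_const (Differentiable.fun_sum fun k _ => ?_) _
    exact (differentiable_apply k).pow 2
  have hq1 (y : P.ComplexSphere) : q y.1 = 1 := by
    simp only [q, y.2]
    exact div_self (pow_ne_zero 2 hr)
  -- The retraction is z ↦ z/√q(z) with the principal root; q = 1 on the complexified sphere, so
  -- points there are fixed.
  let s : (Fin (P.d + 1) → ℂ) → ℂ := fun z => Complex.exp (-(Complex.log (q z) / 2))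
  have hs {z : Fin (P.d + 1) → ℂ} (hz : q z ∈ Complex.slitPlane) :
      ∑ k, (s z • z) k ^ 2 = (P.r : ℂ) ^ 2 := by
    have h0 : q z ≠ 0 := Complex.slitPlane_ne_zero hz
    have h1 : s z ^ 2 * q z = 1 := by
      have : s z ^ 2 = (q z)⁻¹ := by
        rw [← Complex.exp_nat_mul, ← Complex.exp_log h0, ← Complex.exp_neg, Complex.exp_log h0]
        congr 1
        push_cast
        ring
      rw [this, inv_mul_cancel₀ h0]
    have h2 : ∑ k, z k ^ 2 = q z * (P.r : ℂ) ^ 2 :=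
      (div_mul_cancel₀ _ (pow_ne_zero 2 hr)).symm
    simp only [Pi.smul_apply, smul_eq_mul, mul_pow, ← Finset.mul_sum]
    rw [h2, ← mul_assoc, h1, one_mul]
  let π : (Fin (P.d + 1) → ℂ) → P.ComplexSphere := fun z =>
    if h : ∑ k, (s z • z) k ^ 2 = (P.r : ℂ) ^ 2 then ⟨s z • z, h⟩ else x
  refine ⟨q ⁻¹' Complex.slitPlane, π, Complex.isOpen_slitPlane.preimage hq.continuous, ?_, ?_, ?_⟩
  · simp [hq1]
  · have hd : DifferentiableOn ℂ (fun z => s z • z) (q ⁻¹' Complex.slitPlane) := by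
      refine DifferentiableOn.smul (DifferentiableOn.cexp ?_) differentiableOn_id
      have hl := (hq.differentiableOn (s := q ⁻¹' Complex.slitPlane)).clog fun z hz => hz
      exact (hl.mul_const (2 : ℂ)⁻¹).neg
    refine hd.congr fun z hz => ?_
    simp only [Function.comp, π, dif_pos (hs hz)]
  · intro y hy
    have h1 : s y.1 = 1 := by simp [s, hq1]
    have h2 : s y.1 • y.1 = y.1 := by rw [h1, one_smul]
    ext1
    simp only [π, dif_pos (hs hy), h2]

/-- Every point of the complexified sphere lies on an entire curve that is real at real times. -/
lemma exists_curve (a : P.ComplexSphere) : ∃ γ : ℂ → P.ComplexSphere,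
    Differentiable ℂ (Subtype.val ∘ γ) ∧ γ Complex.I = a ∧
      ∀ θ : ℝ, ∃ x : P.Sphere, γ θ = P.ofReal x := by
  obtain ⟨e₁, e₂, t, h₁, h₂, h₁₂, -, -, hta⟩ := exists_circle_eq a
  -- Rescaling time by t lets every curve reach its point at the same time `Complex.I`, so two
  -- curves can be run simultaneously in a product.
  refine ⟨fun z => ⟨P.circle e₁ e₂ (t * z), sum_circle_sq h₁ h₂ h₁₂ _⟩, ?_, Subtype.ext hta, ?_⟩
  · exact (differentiable_circle e₁ e₂).comp (differentiable_id.const_mul (t : ℂ))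
  · intro θ
    obtain ⟨x, hx⟩ := exists_ofReal_circle h₁ h₂ h₁₂ (t * θ)
    refine ⟨x, Subtype.ext ?_⟩
    rw [hx]
    simp

lemma eq_of_eq_ofReal {F F' : P.ComplexSphere → ℂ}
    (hF : IsHolomorphicAlong (Subtype.val : P.ComplexSphere → Fin (P.d + 1) → ℂ) F)
    (hF' : IsHolomorphicAlong (Subtype.val : P.ComplexSphere → Fin (P.d + 1) → ℂ) F')
    (h : ∀ x, F (P.ofReal x) = F' (P.ofReal x)) : F = F' := by
  funext a
  obtain ⟨γ, hγ, rfl, hγr⟩ := exists_curve a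
  refine IsHolomorphicAlong.eq_of_curve hF hF' hγ (fun θ => ?_) Complex.I
  obtain ⟨x, hx⟩ := hγr θ
  rw [hx, h]

lemma eq_of_eq_ofReal_prod {F F' : P.ComplexSphere × P.ComplexSphere → ℂ}
    (hF : IsHolomorphicAlong (Prod.map Subtype.val Subtype.val :
      P.ComplexSphere × P.ComplexSphere → (Fin (P.d + 1) → ℂ) × (Fin (P.d + 1) → ℂ)) F)
    (hF' : IsHolomorphicAlong (Prod.map Subtype.val Subtype.val :
      P.ComplexSphere × P.ComplexSphere → (Fin (P.d + 1) → ℂ) × (Fin (P.d + 1) → ℂ)) F')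
    (h : ∀ x y, F (P.ofReal x, P.ofReal y) = F' (P.ofReal x, P.ofReal y)) : F = F' := by
  funext ⟨a, b⟩
  obtain ⟨γ, hγ, rfl, hγr⟩ := exists_curve a
  obtain ⟨γ', hγ', rfl, hγr'⟩ := exists_curve b
  refine IsHolomorphicAlong.eq_of_curve (γ := fun z => (γ z, γ' z)) hF hF' (hγ.prodMk hγ')
    (fun θ => ?_) Complex.I
  obtain ⟨x, hx⟩ := hγr θ
  obtain ⟨y, hy⟩ := hγr' θ
  simp only [hx, hy, h]

/-! ### Coherent states and the heat kernel -/

variable (P) in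
/-- The coherent states as vectors of the Hilbert space. -/
def coherent (a : P.ComplexSphere) : P.Hilb := ∑' n, (P.decay n : ℂ) • P.zonal n a.1

variable (P) in
/-- The holomorphically continued heat kernel. -/
def heat (p : P.ComplexSphere × P.ComplexSphere) : ℂ :=
  ∑' n, (P.decay n : ℂ) * MvPolynomial.eval p.2.1 (P.zonalPoly n p.1.1)

lemma growth_mono {R R' : ℝ} (h : R ≤ R') : P.growth R ≤ P.growth R' := by
  have := P.r_pos
  unfold growth
  gcongr

lemma norm_decay_smul_zonal_le (n : ℕ) (a : P.ComplexSphere) {R : ℝ} (ha : ‖a.1‖ ≤ R) :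
    ‖(P.decay n : ℂ) • P.zonal n a.1‖ ≤ P.decay n * (P.growth R ^ n * √(P.evalBound n)) := by
  rw [norm_smul, Complex.norm_real, Real.norm_of_nonneg (P.decay_pos n).le]
  refine mul_le_mul_of_nonneg_left ((norm_zonal_le n a).trans ?_) (P.decay_pos n).le
  have h1 := growth_mono (P := P) ha
  have h2 := growth_nonneg (P := P) (norm_nonneg a.1)
  gcongr

lemma hasSum_coherent (a : P.ComplexSphere) :
    HasSum (fun n => (P.decay n : ℂ) • P.zonal n a.1) (P.coherent a) :=
  (Summable.of_norm_bounded (summable_decay_mul_sqrt (growth_nonneg (norm_nonneg a.1)))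
    fun n => norm_decay_smul_zonal_le n a le_rfl).hasSum

lemma isHolomorphicAlong_coherent :
    IsHolomorphicAlong (Subtype.val : P.ComplexSphere → Fin (P.d + 1) → ℂ) P.coherent := by
  refine isHolomorphicAlong_tsum isHolomorphicRetract_complexSphere
    (G := fun n z => (P.decay n : ℂ) • P.zonal n z)
    (fun n => (differentiable_zonal n).fun_const_smul _) fun R => ?_
  refine ⟨_, summable_decay_mul_sqrt (P := P) (growth_nonneg (P := P) (le_max_right R 0)), fun n x hx => ?_⟩
  exact norm_decay_smul_zonal_le n x (hx.trans (le_max_left _ _))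

lemma isHolomorphicAlong_heat :
    IsHolomorphicAlong (Prod.map Subtype.val Subtype.val :
      P.ComplexSphere × P.ComplexSphere → (Fin (P.d + 1) → ℂ) × (Fin (P.d + 1) → ℂ)) P.heat := by
  refine isHolomorphicAlong_tsum
    (isHolomorphicRetract_complexSphere.prodMap isHolomorphicRetract_complexSphere)
    (G := fun n p => (P.decay n : ℂ) * MvPolynomial.eval p.2 (P.zonalPoly n p.1))
    (fun n => (differentiable_eval_zonalPoly n).const_mul _) fun R => ?_
  have hg := growth_nonneg (P := P) (le_max_right R 0)
  refine ⟨_, summable_decay_mul_evalBound (P := P) (K := P.growth (max R 0) * P.growth (max R 0))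
    (by positivity), fun n x hx => ?_⟩
  rw [norm_mul, Complex.norm_real, Real.norm_of_nonneg (P.decay_pos n).le]
  refine mul_le_mul_of_nonneg_left ((norm_eval_zonalPoly_le n x.1 x.2).trans ?_) (P.decay_pos n).le
  have h1 : ‖x.1.1‖ ≤ max R 0 := ((norm_fst_le _).trans hx).trans (le_max_left _ _)
  have h2 : ‖x.2.1‖ ≤ max R 0 := ((norm_snd_le _).trans hx).trans (le_max_left _ _)
  have h3 := growth_mono (P := P) h1
  have h4 := growth_mono (P := P) h2
  have h5 := growth_nonneg (P := P) (norm_nonneg x.1.1)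
  have h6 := growth_nonneg (P := P) (norm_nonneg x.2.1)
  have := evalBound_nonneg (P := P) n
  gcongr

/-- A series of polynomial functions that converges uniformly. -/
lemma exists_continuous_sum {F : ℕ → P.smoothAlg} (hF : ∀ n, F n ∈ P.polyFns n) {M : ℕ → ℝ}
    (hM : Summable fun n => P.decay n * (M n * √(P.evalBound n)))
    (hFM : ∀ n, ‖P.toL2S (F n)‖ ≤ M n) : ∃ g : C(P.Sphere, ℂ),
      HasSum (fun n => (P.decay n : ℂ) • P.toL2S (F n)) (P.toL2 g) ∧
      ∀ x, HasSum (fun n => (P.decay n : ℂ) * (F n).1 x) (g x) := by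
  have hs : Summable fun n => (P.decay n : ℂ) • (F n).1 := by
    refine Summable.of_norm_bounded hM fun n => ?_
    rw [norm_smul, Complex.norm_real, Real.norm_of_nonneg (P.decay_pos n).le]
    refine mul_le_mul_of_nonneg_left ?_ (P.decay_pos n).le
    have h0 : 0 ≤ M n := (norm_nonneg _).trans (hFM n)
    refine (ContinuousMap.norm_le _ (by positivity)).2 fun x => ?_
    refine (norm_apply_le (hF n) x).trans ?_
    rw [mul_comm]
    exact mul_le_mul_of_nonneg_right (hFM n) (Real.sqrt_nonneg _)
  refine ⟨∑' n, (P.decay n : ℂ) • (F n).1, ?_, fun x => ?_⟩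
  · simpa only [map_smul, toL2S_apply] using hs.hasSum.mapL P.toL2
  · simpa using hs.hasSum.mapL (ContinuousMap.evalCLM ℂ x)

/-- The smoothing operator has continuous values. -/
lemma exists_continuous_expJ (φ : P.Hilb) : ∃ g : C(P.Sphere, ℂ),
    P.toL2 g = P.expJ (-(P.τ / 2)) φ ∧ ∀ x, g x = inner ℂ (P.coherent (P.ofReal x)) φ := by
  have h (n : ℕ) : ∃ f ∈ P.polyFns n, P.toL2S f = P.Q n φ := by
    obtain ⟨f, hf, hfQ, -⟩ := P.exists_of_mem_harm (P.Q_mem n φ)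
    exact ⟨f, hf, hfQ⟩
  choose F hF hFQ using h
  have hs : Summable fun n => P.decay n * (‖φ‖ * √(P.evalBound n)) := by
    refine ((summable_decay_mul_sqrt (P := P) zero_le_one).mul_left ‖φ‖).congr fun n => ?_
    rw [one_pow]; ring
  obtain ⟨g, hg, hgx⟩ := exists_continuous_sum hF hs fun n => by
    rw [hFQ]; exact P.norm_Q_le n φ
  refine ⟨g, ?_, fun x => ?_⟩
  · simp only [hFQ] at hg
    exact hg.unique (P.hasSum_expJ φ)
  · refine (hgx x).unique ?_
    have h1 := (hasSum_coherent (P.ofReal x)).mapL (innerSL ℂ φ)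
    have h2 := h1.mapL Complex.conjCLE.toContinuousLinearMap
    simp only [innerSL_apply_apply] at h2
    convert! h2 using 1
    · funext n
      have h3 := inner_zonal_ofReal (hF n) (by rw [hFQ]; exact P.Q_mem n φ) x
      rw [hFQ, P.inner_Q_of_mem (zonal_mem n _)] at h3
      rw [← h3, inner_smul_right]
      simp
    · simp

lemma exists_continuous_coherent (a : P.ComplexSphere) : ∃ g : C(P.Sphere, ℂ),
    P.toL2 g = P.coherent a ∧ ∀ x, g x = P.heat (a, P.ofReal x) := by
  obtain ⟨g, hg, hgx⟩ := exists_continuous_sum (F := fun n => P.res (P.zonalPoly n a.1))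
    (M := fun n => P.growth ‖a.1‖ ^ n * √(P.evalBound n)) (fun n => P.res_mem (zonalPoly_mem n _))
    (by
      refine (summable_decay_mul_evalBound (P := P)
        (growth_nonneg (P := P) (norm_nonneg a.1))).congr fun n => ?_
      rw [mul_assoc (P.growth _ ^ n), Real.mul_self_sqrt (evalBound_nonneg n)])
    (fun n => by rw [toL2S_res_zonalPoly]; exact norm_zonal_le n a)
  refine ⟨g, ?_, fun x => ?_⟩
  · simp only [toL2S_res_zonalPoly] at hg
    exact hg.unique (hasSum_coherent a)
  · simp only [res_apply] at hgx
    exact (hgx x).tsum_eq.symm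

lemma conj_heat_ofReal (x y : P.Sphere) :
    conj (P.heat (P.ofReal x, P.ofReal y)) = P.heat (P.ofReal x, P.ofReal y) := by
  rw [heat, Complex.conj_tsum]
  simp only [map_mul, Complex.conj_ofReal, conj_eval_zonalPoly]

lemma coe_toL2 (g : C(P.Sphere, ℂ)) : P.toL2 g =ᵐ[P.surfaceMeasure] g :=
  ContinuousMap.coeFn_toLp P.surfaceMeasure g

lemma coherent_ae_eq (a : P.ComplexSphere) :
    P.coherent a =ᵐ[P.surfaceMeasure] fun x => P.heat (a, P.ofReal x) := by
  obtain ⟨g, hg, hgx⟩ := exists_continuous_coherent a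
  rw [← hg]
  filter_upwards [coe_toL2 g] with x hx
  rw [hx, hgx]

lemma continuous_val_ofReal : Continuous fun x : P.Sphere => (P.ofReal x).1 := by
  unfold ofReal
  fun_prop

/-- The smoothed function at x is ⟨ψ_x, φ⟩, and ψ_x is represented by the kernel, which is real on
real points, so the conjugation in the inner product disappears. -/
lemma isHeatKernel_heat : P.IsHeatKernel fun p => P.heat (P.ofReal p.1, P.ofReal p.2) := by
  constructor
  · refine IsHolomorphicAlong.continuous_comp isHolomorphicAlong_heat
      (c := fun p : P.Sphere × P.Sphere => (P.ofReal p.1, P.ofReal p.2)) ?_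
    exact (continuous_val_ofReal.comp continuous_fst).prodMk
      (continuous_val_ofReal.comp continuous_snd)
  · intro φ
    obtain ⟨g, hg, hgx⟩ := exists_continuous_expJ φ
    rw [← hg]
    filter_upwards [coe_toL2 g] with x hx
    rw [hx, hgx, L2.inner_def]
    refine integral_congr_ae ?_
    filter_upwards [coherent_ae_eq (P.ofReal x)] with y hy
    rw [hy, RCLike.inner_apply, conj_heat_ofReal, mul_comm]

lemma isHeatKernel_unique {ρ ρ' : P.Sphere × P.Sphere → ℂ} (h : P.IsHeatKernel ρ)
    (h' : P.IsHeatKernel ρ') : ρ = ρ' := by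
  have hint {ρ : P.Sphere × P.Sphere → ℂ} (hρ : Continuous ρ) (x : P.Sphere) (f : C(P.Sphere, ℂ)) :
      Integrable (fun y => ρ (x, y) * f y) P.surfaceMeasure :=
    P.integrable_continuousMap ⟨fun y => ρ (x, y) * f y, by fun_prop⟩
  have hcont {ρ : P.Sphere × P.Sphere → ℂ} (hρ : Continuous ρ) (f : C(P.Sphere, ℂ)) :
      Continuous fun x => ∫ y, ρ (x, y) * f y ∂P.surfaceMeasure := by
    refine continuous_parametric_integral_of_continuous (s := Set.univ) ?_ isCompact_univ |>.congr
      fun x => by rw [Measure.restrict_univ]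
    fun_prop
  have hae {ρ : P.Sphere × P.Sphere → ℂ} (hρ : P.IsHeatKernel ρ) (f : C(P.Sphere, ℂ)) :
      P.expJ (-(P.τ / 2)) (P.toL2 f) =ᵐ[P.surfaceMeasure]
        fun x => ∫ y, ρ (x, y) * f y ∂P.surfaceMeasure := by
    filter_upwards [hρ.2 (P.toL2 f)] with x hx
    rw [hx]
    refine integral_congr_ae ?_
    filter_upwards [coe_toL2 f] with y hy
    rw [hy]
  have heq (f : C(P.Sphere, ℂ)) := ((hcont h.1 f).ae_eq_iff_eq P.surfaceMeasure
    (hcont h'.1 f)).1 ((hae h f).symm.trans (hae h' f))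
  have hc := h.1
  have hc' := h'.1
  funext ⟨x, y⟩
  -- Testing both kernels on the conjugate of their difference at fixed x gives ∫ |k|² = 0.
  -- Continuity has already upgraded equality for almost all x to all x.
  let k : C(P.Sphere, ℂ) := ⟨fun y => ρ (x, y) - ρ' (x, y), by fun_prop⟩
  have h1 := congrFun (heq (star k)) x
  rw [← sub_eq_zero, ← integral_sub (hint hc x _) (hint hc' x _)] at h1
  have h2 : inner ℂ (P.toL2 k) (P.toL2 k) = 0 := by
    rw [inner_toL2, ← h1]
    refine integral_congr_ae (.of_forall fun y => ?_)
    simp [k]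
    ring
  have h3 : k = 0 := ContinuousMap.toLp_injective P.surfaceMeasure
    ((inner_self_eq_zero.1 h2).trans (map_zero P.toL2).symm)
  exact sub_eq_zero.1 (congrArg (fun k => k y) h3)

end

end SphereParticle

namespace SphereParticle

noncomputable section

variable {P : SphereParticle}

/-! ### The annihilation operators -/

lemma sum_Q_of_mem {D : ℕ} {φ : P.Hilb} (hφ : φ ∈ P.polyL2 D) :
    ∑ n ∈ Finset.range (D + 1), P.Q n φ = φ := by
  rw [← sub_eq_zero, ← neg_eq_zero, neg_sub]
  refine P.eq_zero_of_orthogonal fun j χ hχ => ?_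
  rw [inner_sub_right, inner_sum, sub_eq_zero]
  rcases lt_or_ge D j with hj | hj
  · rw [← inner_conj_symm, P.inner_eq_zero_of_lt hj hφ hχ, map_zero]
    refine (Finset.sum_eq_zero fun n hn => P.inner_harm_of_ne ?_ hχ (P.Q_mem n φ)).symm
    have := Finset.mem_range.1 hn
    omega
  · rw [Finset.sum_eq_single_of_mem j (Finset.mem_range.2 (by omega)) fun n _ hn =>
      P.inner_harm_of_ne hn.symm hχ (P.Q_mem n φ), P.inner_Q_of_mem hχ]

/-- Splits the restriction of p into its harmonic parts and reproduces each. This is needed because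
x_k times a harmonic is no longer harmonic. -/
lemma sum_inner_zonal {D : ℕ} {p : MvPolynomial (Fin (P.d + 1)) ℂ} (hp : p ∈ P.polys D)
    (a : P.ComplexSphere) : ∑ n ∈ Finset.range (D + 1),
      inner ℂ (P.zonal n a.1) (P.toL2S (P.res p)) = MvPolynomial.eval (conjPt a).1 p := by
  have h (n : ℕ) : ∃ q, P.toL2S (P.res q) = P.Q n (P.toL2S (P.res p)) := by
    obtain ⟨f, hf, hfQ, -⟩ := P.exists_of_mem_harm (P.Q_mem n (P.toL2S (P.res p)))
    obtain ⟨q, -, rfl⟩ := P.exists_res_eq hf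
    exact ⟨q, hfQ⟩
  choose q hq using h
  have h1 : P.res (∑ n ∈ Finset.range (D + 1), q n) = P.res p := by
    apply P.toL2S_injective
    rw [map_sum, map_sum]
    simp only [hq]
    exact sum_Q_of_mem ⟨_, P.res_mem hp, rfl⟩
  rw [← eval_eq_of_res_eq h1, map_sum]
  refine Finset.sum_congr rfl fun n _ => ?_
  rw [← inner_zonal (by rw [hq]; exact P.Q_mem _ _), hq, P.inner_Q_of_mem (zonal_mem n _)]

lemma X_toL2S (k : Fin (P.d + 1)) (f : P.smoothAlg) :
    P.X k (P.toL2S f) = P.toL2S (P.coordS k * f) := by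
  apply Lp.ext
  refine (MemLp.coeFn_toLp _).trans ?_
  filter_upwards [coe_toL2 f.1, coe_toL2 (P.coordS k * f).1] with x hx hx'
  rw [toL2S_apply, toL2S_apply, hx, hx']
  rfl

lemma inner_coordS_mul (k : Fin (P.d + 1)) (f g : P.smoothAlg) :
    inner ℂ (P.toL2S f) (P.toL2S (P.coordS k * g)) =
      inner ℂ (P.toL2S (P.coordS k * f)) (P.toL2S g) := by
  rw [toL2S_apply, toL2S_apply, toL2S_apply, toL2S_apply, inner_toL2, inner_toL2]
  refine integral_congr_ae (.of_forall fun x => ?_)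
  simp [coordS, coord]
  ring

variable (P) in
/-- The product of a coordinate function with a zonal harmonic. -/
def coordZonal (k : Fin (P.d + 1)) (n : ℕ) (a : Fin (P.d + 1) → ℂ) : P.Hilb :=
  P.toL2S (P.coordS k * P.res (P.zonalPoly n a))

lemma inner_coordZonal (k : Fin (P.d + 1)) (n : ℕ) (a : Fin (P.d + 1) → ℂ) (f : P.smoothAlg) :
    inner ℂ (P.toL2S f) (P.coordZonal k n a) =
      inner ℂ (P.toL2S (P.coordS k * f)) (P.zonal n a) := by
  rw [coordZonal, inner_coordS_mul, toL2S_res_zonalPoly]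

/-- Multiplication by x_k is symmetric and raises degree m to at most m+1, which is orthogonal to
`harm n`. -/
lemma Q_coordZonal_eq_zero (k : Fin (P.d + 1)) {m n : ℕ} (h : m + 1 < n)
    (a : Fin (P.d + 1) → ℂ) : P.Q m (P.coordZonal k n a) = 0 := by
  refine P.Q_eq_zero fun χ hχ => ?_
  obtain ⟨f, hf, rfl, -⟩ := P.exists_of_mem_harm hχ
  rw [inner_coordZonal]
  exact P.inner_eq_zero_of_lt h ⟨_, mul_mem_polySpan _ k hf, rfl⟩ (zonal_mem n a)

/-- Pair with a harmonic p of degree m: moving x_k to p and summing over n ≤ m+1 reproduces x_k p at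
the conjugate point, up to conjugation. That value is the product of the coordinate with p, and p
reproduces through `zonal m` alone. -/
lemma sum_Q_coordZonal (k : Fin (P.d + 1)) (m : ℕ) (a : P.ComplexSphere) :
    ∑ n ∈ Finset.range (m + 2), P.Q m (P.coordZonal k n a.1) = a.1 k • P.zonal m a.1 := by
  rw [← sub_eq_zero]
  have hmem : ∑ n ∈ Finset.range (m + 2), P.Q m (P.coordZonal k n a.1) - a.1 k • P.zonal m a.1 ∈
      P.harm m := sub_mem (Submodule.sum_mem _ fun n _ => P.Q_mem m _)
        (Submodule.smul_mem _ _ (zonal_mem m _))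
  have h (χ : P.Hilb) (hχ : χ ∈ P.harm m) : inner ℂ χ
      (∑ n ∈ Finset.range (m + 2), P.Q m (P.coordZonal k n a.1) - a.1 k • P.zonal m a.1) = 0 := by
    obtain ⟨f, hf, rfl, -⟩ := P.exists_of_mem_harm hχ
    obtain ⟨p, hp, rfl⟩ := P.exists_res_eq hf
    have h1 := sum_inner_zonal (mul_mem_polySpan MvPolynomial.X k hp) a
    have h2 := inner_zonal hχ a
    have h3 : P.res (MvPolynomial.X k * p) = P.coordS k * P.res p := by simp [res]
    rw [map_mul (MvPolynomial.eval _), MvPolynomial.eval_X, ← h2, h3] at h1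
    have h4 := congrArg conj h1
    rw [map_sum, map_mul (starRingEnd ℂ)] at h4
    simp only [inner_conj_symm, conjPt, Complex.conj_conj] at h4
    rw [inner_sub_right, inner_sum, inner_smul_right, sub_eq_zero, ← h4]
    refine Finset.sum_congr rfl fun n _ => ?_
    rw [P.inner_Q_of_mem hχ, inner_coordZonal]
  exact inner_self_eq_zero.1 (h _ hmem)

lemma Q_coherent (n : ℕ) (a : P.ComplexSphere) :
    P.Q n (P.coherent a) = (P.decay n : ℂ) • P.zonal n a.1 :=
  P.Q_of_hasSum (fun m => Submodule.smul_mem _ _ (zonal_mem m _)) (hasSum_coherent a) n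

lemma coherent_ne_zero (a : P.ComplexSphere) : P.coherent a ≠ 0 := by
  intro h
  have h1 := Q_coherent 0 a
  rw [h, map_zero] at h1
  refine smul_ne_zero ?_ (zonal_ne_zero a) h1.symm
  exact_mod_cast (P.decay_pos 0).ne'

lemma annihilationMin_zero (k : Fin (P.d + 1)) : P.annihilationMin k 0 = 0 := by
  have h (s : ℝ) : P.expJ s 0 = 0 := by
    rw [P.expJ_of_mem s (zero_mem (P.harm 0)), smul_zero]
  have hX : P.X k 0 = 0 := by
    have := X_toL2S k (P := P) 0
    rwa [map_zero, mul_zero, map_zero] at this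
  rw [annihilationMin, h, hX, h]

/-- The inner exponential cancels the factor `decay n` of the coherent state, and the outer one
contributes `decay m`, independent of n. -/
lemma Q_annihilationMin (k : Fin (P.d + 1)) (m n : ℕ) (a : P.ComplexSphere) :
    P.Q m (P.annihilationMin k (P.Q n (P.coherent a))) =
      (P.decay m : ℂ) • P.Q m (P.coordZonal k n a.1) := by
  have h1 : P.expJ (P.τ / 2) (P.Q n (P.coherent a)) = P.zonal n a.1 := by
    rw [P.expJ_of_mem _ (P.Q_mem n _), Q_coherent, smul_smul, ← Complex.ofReal_mul, decay,
      ← Real.exp_add]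
    simp
  rw [annihilationMin, h1, Q_expJ, ← toL2S_res_zonalPoly, X_toL2S]
  rfl

lemma annihilationEq_coherent (k : Fin (P.d + 1)) (a : P.ComplexSphere) :
    P.AnnihilationEq k (P.coherent a) (a.1 k • P.coherent a) := by
  classical
  rw [AnnihilationEq, ← P.ev_strictMono.injective.hasSum_iff]
  · convert! (hasSum_coherent a).const_smul (a.1 k) using 1
    funext m
    simp only [Function.comp, proj_ev]
    -- Only eigenvalues `ev n` with n ≤ m+1 contribute to degree m.
    rw [finsum_eq_sum_of_support_subset (s := (Finset.range (m + 2)).image P.ev),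
      Finset.sum_image P.ev_strictMono.injective.injOn]
    · simp only [proj_ev, Q_annihilationMin]
      rw [← Finset.smul_sum, sum_Q_coordZonal, smul_comm]
    · intro mu hmu
      by_contra hcon
      apply hmu
      by_cases hr : mu ∈ Set.range P.ev
      · obtain ⟨n, rfl⟩ := hr
        simp only [proj_ev, Q_annihilationMin]
        rw [Q_coordZonal_eq_zero, smul_zero]
        by_contra hn
        exact hcon (Finset.mem_coe.2 (Finset.mem_image_of_mem _ (Finset.mem_range.2 (by omega))))
      · simp only [P.proj_of_ne hr, zero_apply, annihilationMin_zero, map_zero]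
  · intro lam hlam
    simp [P.proj_of_ne hlam]

/-! ### The family of coherent states -/

lemma isCoherentFamily_coherent : P.IsCoherentFamily fun a => P.ket (P.coherent a) := by
  constructor
  · intro f x
    obtain ⟨U, G, hU, hxU, hG, hGF⟩ := isHolomorphicAlong_coherent (P := P) x
    refine ⟨U, fun z => innerSL ℂ (P.toL2 f) (G z), hU, hxU,
      (innerSL ℂ (P.toL2 f)).differentiable.comp_differentiableOn hG, fun y hy => ?_⟩
    simp only [hGF y hy]
    rfl
  · intro x f g hg
    obtain ⟨g', hg', hgx⟩ := exists_continuous_expJ (P.toL2 f.1)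
    have h : g = g' := ContinuousMap.toLp_injective P.surfaceMeasure (hg.trans hg'.symm)
    change inner ℂ (P.toL2 f.1) (P.coherent (P.ofReal x)) = conj (g x)
    rw [h, hgx, inner_conj_symm]

lemma isCoherentFamily_unique {Ψ Ψ' : P.ComplexSphere → P.GenState} (h : P.IsCoherentFamily Ψ)
    (h' : P.IsCoherentFamily Ψ') : Ψ' = Ψ := by
  funext a
  refine LinearMap.ext fun f => ?_
  refine congrFun (eq_of_eq_ofReal (h'.1 f) (h.1 f) fun x => ?_) a
  -- `IsSmoothingOf` fixes the value only through a continuous representative, so its existence is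
  -- what makes the condition determine the state.
  obtain ⟨g, hg, -⟩ := exists_continuous_expJ (P.toL2 f.1)
  rw [h.2 x f g hg, h'.2 x f g hg]

end

end SphereParticle

theorem mainTheorem4 (P : SphereParticle) :
    ∃ Ψ : P.ComplexSphere → P.GenState,
      P.IsCoherentFamily Ψ ∧
      (∀ Ψ' : P.ComplexSphere → P.GenState, P.IsCoherentFamily Ψ' → Ψ' = Ψ) ∧
      ∃ ψ : P.ComplexSphere → P.Hilb,
        (∀ a, Ψ a = P.ket (ψ a)) ∧
        IsHolomorphicAlong (Subtype.val : P.ComplexSphere → Fin (P.d + 1) → ℂ) ψ ∧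
        (∀ a, ψ a ≠ 0 ∧ ∀ k, P.AnnihilationEq k (ψ a) (a.1 k • ψ a)) ∧
        ∃ ρ : P.ComplexSphere × P.ComplexSphere → ℂ,
          P.IsContinuedHeatKernel ρ ∧
          (∀ ρ', P.IsContinuedHeatKernel ρ' → ρ' = ρ) ∧
          ∀ a, ψ a =ᵐ[P.surfaceMeasure] fun x => ρ (a, P.ofReal x) := by
  have hcf := SphereParticle.isCoherentFamily_coherent (P := P)
  refine ⟨fun a => P.ket (P.coherent a), hcf,
    fun Ψ' h => SphereParticle.isCoherentFamily_unique hcf h, P.coherent, fun _ => rfl,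
    SphereParticle.isHolomorphicAlong_coherent,
    fun a => ⟨SphereParticle.coherent_ne_zero a, fun k =>
      SphereParticle.annihilationEq_coherent k a⟩,
    P.heat, ⟨SphereParticle.isHolomorphicAlong_heat, SphereParticle.isHeatKernel_heat⟩,
    fun ρ' h => ?_, SphereParticle.coherent_ae_eq⟩
  refine SphereParticle.eq_of_eq_ofReal_prod h.1 SphereParticle.isHolomorphicAlong_heat
    fun x y => ?_
  exact congrFun (SphereParticle.isHeatKernel_unique h.2 SphereParticle.isHeatKernel_heat) (x, y)
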